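/- **Conventions.** Let $\tau$ be a finite vocabulary consisting of predicates only, and $\tau^+=\tau\cup\{\in\}$. For a finite nonempty $\tau$-model $M$, whose elements are treated as urelements, let $V_0[M]=M$ and $V_{t+1}[M]=V_t[M]\cup\mathcal P(V_t[M])$. An *inductive scheme* $\Upsilon$ consists of first order formulas $\psi_i(x;\bar y_i)$ $(i<m_0)$ and $\varphi_l(x)$ $(l<m_1)$ in the vocabulary $\tau^+\cup\{P_l:l<m_1\}$ with new unary predicates $P_l$. Its computation on $M$ is: $N_0=M$ with all $P_l$ empty; given $N_t\subseteq V_t[M]$ and the predicates at time $t$ (the predicates of $\tau$ are those of $M$ and hold of urelements only), with resulting structure $N_t^+$, put $$\mathcal P_{t,i}=\bigl\{\{a\in N_t:N_t^+\models\psi_i(a,\bar b)\}:\bar b\in{}^{\ell g(\bar y_i)}N_t\bigr\},\qquad c_{t,l}=\{a\in N_t:N_t^+\models\varphi_l(a)\},$$ $N_{t+1}=N_t\cup\bigcup_{i<m_0}\mathcal P_{t,i}$, and let $P_l$ at time $t+1$ hold exactly of those elements of $N_{t+1}$ that are equal to $c_{t,l}$. Let $\mathbf t:\mathbb N\to\mathbb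 N\cup\{\infty\}$, and let $\iota\in\{2,3,4\}$. Say that the computation *overflows* at $t$ if $\|N_{t+1}\|+(t+1)>\mathbf t(\|M\|)$ (for $\iota=2$); if $\|N_{t+1}\|>\mathbf t(\|M\|)$ (for $\iota=3$); if $|\mathcal P_{t,i}|>\mathbf t(\|M\|)$ for some $i<m_0$ (for $\iota=4$). Say that it *halts* at $t$ if $m_1\ge 2$ and $c_{t,0}=c_{t,1}$. The *stopping time* $t_\iota[M,\Upsilon,\mathbf t]\in\mathbb N\cup\{\infty\}$ is the least $t$ at which it halts or overflows ($\infty$ if there is none). For a first order sentence $\chi$ of $\tau^+$, the *truth value* of $\theta_{\Upsilon,\chi,\mathbf t}$ in $M$ is the truth value of $\chi$ in $N_t$ for $t=t_\iota[M,\Upsilon,\mathbf t]$ if this $t$ is finite and the computation halts at $t$; otherwise it is undefined. **Claim.** Let $k,s\in\mathbb N$ with $3s\le k$, let $\iota\in\{2,3,4\}$, and for $\ell=1,2$ let $M_\ell$ be a finite nonempty $\tau$-model and $\mathbf t_\ell:\mathbb N\to\mathbb N\cup\{\infty\}$. Write $\mathbf t_\ell(M_\ell)=\mathbf t_\ell(\|M_\ell\|)$.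 Assume, for $\ell=1,2$: 1. $M_\ell$ has $k$-elimination of quantifiers: every isomorphism $f$ from $M_\ell\restriction A_0$ onto $M_\ell\restriction A_1$, where $|A_0|=|A_1|<k$, extends, for every $a_0\in M_\ell$, to an isomorphism between substructures of $M_\ell$ whose domain contains $A_0\cup\{a_0\}$. 2. If $m\le s$ and $\varphi(\bar x,\bar y)$, with $\ell g(\bar x)=\ell g(\bar y)=m$, is a quantifier free $\tau$-formula without parameters that defines an equivalence relation on ${}^m M_\ell$, then the number of its classes is $\ge\mathbf t_\ell(M_\ell)$ (for $\iota=4$: $>\mathbf t_\ell(M_\ell)$), or each of its classes is the set of realizations in $M_\ell$ of a quantifier free type over the empty set (a set of quantifier free formulas in $m$ variables, not necessarily complete). 3. Every substructure of $M_\ell$ with at most $k$ elements is embeddable in $M_{3-\ell}$ (that is, $M_1$ and $M_2$ realize the same quantifier free types in at most $k$ variables). Let $\Upsilon$ be an inductive scheme and $\chi$ a first order sentence of $\tau^+$ such that $\ell g(\bar y_i)\le s$ for all $i$ and every subformula of $\chi$ and of any formula of $\Upsilon$ has at most $s$ free variables. Then the truth value of $\theta_{\Upsilon,\chi,\mathbf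 t_1}$ in $M_1$ equals the truth value of $\theta_{\Upsilon,\chi,\mathbf t_2}$ in $M_2$ (both may be undefined), except possibly when, for some $\ell\in\{1,2\}$, the truth value of $\theta_{\Upsilon,\chi,\mathbf t_\ell}$ in $M_\ell$ is undefined, that of $\theta_{\Upsilon,\chi,\mathbf t_{3-\ell}}$ in $M_{3-\ell}$ is defined, and $t_\iota[M_\ell,\Upsilon,\mathbf t_\ell]<t_\iota[M_{3-\ell},\Upsilon,\mathbf t_{3-\ell}]$. -/

import Mathlib

open FirstOrder

universe u v w

namespace ChoicelessPTime

/-! ### Sets over urelements -/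

/-- `V M t` is the `t`-th level of the cumulative hierarchy over the set `M` of urelements:
`V₀ = M` and `V_{t+1} = V_t ∪ {a : a ⊆ V_t}`.  As every set in `V_t` is a subset of `V_t`,
an element of `V_{t+1}` is either an urelement or a subset of `V_t`. -/
def V (M : Type w) : ℕ → Type w
  | 0 => M
  | t + 1 => M ⊕ Set (V M t)

variable {M : Type w}

/-- The urelement `a` as an element of `V_t`. -/
def V.atom : (t : ℕ) → M → V M t
  | 0, a => a
  | _ + 1, a => Sum.inl a

/-- The inclusion of `V_t` in `V_{t+1}`. -/
def V.lift : (t : ℕ) → V M t → V M (t + 1)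
  | 0, a => Sum.inl a
  | _ + 1, Sum.inl a => Sum.inl a
  | t + 1, Sum.inr X => Sum.inr (V.lift t '' X)

/-- The subset `X` of `V_t` as an element of `V_{t+1}`. -/
def V.ofSet {t : ℕ} (X : Set (V M t)) : V M (t + 1) := Sum.inr X

/-- `V.Mem t y x` is the membership `y ∈ x` between elements of `V_t`; urelements have no
members. -/
def V.Mem : (t : ℕ) → V M t → V M t → Prop
  | 0, _, _ => False
  | _ + 1, _, Sum.inl _ => False
  | t + 1, y, Sum.inr X => ∃ z ∈ X, V.lift t z = y

/-! ### Languages, and the number of free variables of subformulas -/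

/-- The symbols that are added to the vocabulary: the binary symbol `∈` and `m` unary
predicates. -/
inductive SetRel (m : ℕ) : ℕ → Type
  | mem : SetRel m 2
  | pred (l : Fin m) : SetRel m 1

/-- The language with the binary symbol `∈` and `m` unary predicates. -/
def setLang (m : ℕ) : FirstOrder.Language.{0, 0} := ⟨fun _ => Empty, SetRel m⟩

/-- The vocabulary `τ ∪ {∈} ∪ {𝒫₀, …, 𝒫_{m-1}}`; for `m = 0` this is `τ⁺ = τ ∪ {∈}`. -/
abbrev extLang (τ : FirstOrder.Language.{u, v}) (m : ℕ) : FirstOrder.Language :=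
  τ.sum (setLang m)

open Classical in
/-- The variables that occur free in a formula.  In a `BoundedFormula α n` these are free
variables named by `α`, or de Bruijn variables in `Fin n`. -/
noncomputable def freeVars {L : FirstOrder.Language.{u, v}} {α : Type w} :
    {n : ℕ} → L.BoundedFormula α n → Set (α ⊕ Fin n)
  | _, .falsum => ∅
  | _, .equal t₁ t₂ => ↑t₁.varFinset ∪ ↑t₂.varFinset
  | _, .rel _ ts => ⋃ i, ↑(ts i).varFinset
  | _, .imp f g => freeVars f ∪ freeVars g
  | _, .all f => {x | Sum.map id Fin.castSucc x ∈ freeVars f}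

/-- Every subformula (the formula itself included) has at most `s` free variables. -/
def SubformulasHaveFewFreeVars (s : ℕ) {L : FirstOrder.Language.{u, v}} {α : Type w} :
    {n : ℕ} → L.BoundedFormula α n → Prop
  | _, .falsum => True
  | _, .equal t₁ t₂ => (freeVars (.equal t₁ t₂)).encard ≤ s
  | _, .rel R ts => (freeVars (.rel R ts)).encard ≤ s
  | _, .imp f g => (freeVars (.imp f g)).encard ≤ s ∧
      SubformulasHaveFewFreeVars s f ∧ SubformulasHaveFewFreeVars s g
  | _, .all f => (freeVars (.all f)).encard ≤ s ∧ SubformulasHaveFewFreeVars s f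

/-! ### Inductive schemes and their computations -/

/-- An inductive scheme `Υ` over the vocabulary `τ`: formulas `ψ_i(x; ȳ_i)`, `i < m₀`, and
`φ_l(x)`, `l < m₁`, in the vocabulary `τ ∪ {∈} ∪ {𝒫_l : l < m₁}`. -/
structure InductiveScheme (τ : FirstOrder.Language.{u, v}) where
  m₀ : ℕ
  m₁ : ℕ
  /-- the length of `ȳ_i` -/
  len : Fin m₀ → ℕ
  ψ : (i : Fin m₀) → (extLang τ m₁).Formula (Unit ⊕ Fin (len i))
  φ : Fin m₁ → (extLang τ m₁).Formula Unit

section Computation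

variable {τ : FirstOrder.Language.{u, v}} [τ.IsRelational]

/-- The structure with universe `N ⊆ V_t`: the predicates of `τ` are those of `M` (so they hold
of urelements only), `∈` is membership, and the `l`-th additional predicate is `P l ∩ N`. -/
@[reducible] def levelStructure [τ.Structure M] {m t : ℕ} (N : Set (V M t))
    (P : Fin m → Set (V M t)) : (extLang τ m).Structure N where
  funMap := fun {_} f _ => isEmptyElim (α := Empty) (f.elim (fun g => isEmptyElim g) id)
  RelMap := fun {_} r =>
    match r with
    | Sum.inl R => fun x => ∃ a : Fin _ → M, (∀ i, (x i : V M t) = V.atom t (a i)) ∧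
        FirstOrder.Language.Structure.RelMap R a
    | Sum.inr SetRel.mem => fun x => V.Mem (M := M) t (x 0) (x 1)
    | Sum.inr (SetRel.pred l) => fun x => (x 0 : V M t) ∈ P l

/-- The state of the computation at time `t`: the set `N_t ⊆ V_t` and the interpretations of
the additional predicates. -/
structure State (M : Type w) (m t : ℕ) where
  N : Set (V M t)
  P : Fin m → Set (V M t)

variable [τ.Structure M] (Υ : InductiveScheme τ)

/-- `𝒫_{t,i} = {{a ∈ N_t : N_t⁺ ⊨ ψ_i(a, b̄)} : b̄ from N_t}`. -/
def State.family {t : ℕ} (S : State M Υ.m₁ t) (i : Fin Υ.m₀) : Set (Set (V M t)) :=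
  letI := levelStructure (τ := τ) S.N S.P
  Set.range fun b : Fin (Υ.len i) → S.N =>
    Subtype.val '' {a : S.N | (Υ.ψ i).Realize (Sum.elim (fun _ => a) b)}

/-- `c_{t,l} = {a ∈ N_t : N_t⁺ ⊨ φ_l(a)}`. -/
def State.c {t : ℕ} (S : State M Υ.m₁ t) (l : Fin Υ.m₁) : Set (V M t) :=
  letI := levelStructure (τ := τ) S.N S.P
  Subtype.val '' {a : S.N | (Υ.φ l).Realize (fun _ => a)}

/-- The computation of `Υ` on `M`: `N₀ = M` with all additional predicates empty;
`N_{t+1} = N_t ∪ ⋃_i 𝒫_{t,i}`, and at time `t + 1` the `l`-th additional predicate holds of the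
set `c_{t,l}` only (of nothing, if `c_{t,l}` is not in `N_{t+1}`). -/
def InductiveScheme.state (M : Type w) [τ.Structure M] : (t : ℕ) → State M Υ.m₁ t
  | 0 => ⟨Set.univ, fun _ => ∅⟩
  | t + 1 =>
    ⟨V.lift t '' (state M t).N ∪ V.ofSet '' ⋃ i, (state M t).family Υ i,
      fun l => {V.ofSet ((state M t).c Υ l)}⟩

/-- `N_t ⊨ χ`, for a sentence `χ` in the vocabulary `τ⁺ = τ ∪ {∈}`. -/
def InductiveScheme.Models (M : Type w) [τ.Structure M] (t : ℕ)
    (χ : (extLang τ 0).Sentence) : Prop :=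
  letI := levelStructure (τ := τ) (m := 0) (Υ.state M t).N (fun l => l.elim0)
  (Υ.state M t).N ⊨ χ

/-! ### Stopping time and truth value -/

/-- The three ways in which a bound on the resources is imposed: on `‖N_{t+1}‖ + (t + 1)`
(the logic with `ι = 2`), on `‖N_{t+1}‖` (`ι = 3`), on the families `𝒫_{t,i}` (`ι = 4`). -/
inductive Clock
  | iota2
  | iota3
  | iota4

/-- The step from time `t` to time `t + 1` exceeds the bound `T`. -/
def InductiveScheme.Overflows (ι : Clock) (M : Type w) [τ.Structure M] (T : ℕ∞) (t : ℕ) : Prop :=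
  match ι with
  | .iota2 => T < (Υ.state M (t + 1)).N.encard + ((t + 1 : ℕ) : ℕ∞)
  | .iota3 => T < (Υ.state M (t + 1)).N.encard
  | .iota4 => ∃ i, T < ((Υ.state M t).family Υ i).encard

/-- The computation announces at time `t` that it has finished: `c_{t,0} = c_{t,1}`. -/
def InductiveScheme.Halts (M : Type w) [τ.Structure M] (t : ℕ) : Prop :=
  ∃ i j : Fin Υ.m₁, (i : ℕ) = 0 ∧ (j : ℕ) = 1 ∧ (Υ.state M t).c Υ i = (Υ.state M t).c Υ j

/-- The stopping time: the first time at which the computation finishes or the next step exceeds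
the bound `T`; it is `⊤` (that is, `∞`) if there is no such time. -/
noncomputable def InductiveScheme.stopTime (ι : Clock) (M : Type w) [τ.Structure M] (T : ℕ∞) :
    ℕ∞ :=
  sInf {x | ∃ t : ℕ, x = (t : ℕ∞) ∧ (Υ.Overflows ι M T t ∨ Υ.Halts M t)}

open Classical in
/-- The truth value of the sentence `θ_{Υ,χ,T}` in `M`.  It is the truth value of `χ` in `N_t` for
the stopping time `t`, if the computation has finished at that time; it is undefined (`none`) if
the computation was stopped because the resources did not suffice, or does not stop. -/
noncomputable def truthValue (ι : Clock) (χ : (extLang τ 0).Sentence) (T : ℕ → ℕ∞)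
    (M : Type w) [τ.Structure M] : Option Bool :=
  if Υ.stopTime ι M (T (Nat.card M)) ≠ ⊤ ∧
      Υ.Halts M (Υ.stopTime ι M (T (Nat.card M))).toNat then
    some (decide (Υ.Models M (Υ.stopTime ι M (T (Nat.card M))).toNat χ))
  else none

end Computation

/-! ### The conditions on the models -/

section Models

variable (τ : FirstOrder.Language.{u, v}) (M : Type w) [τ.Structure M]

/-- `k`-elimination of quantifiers: every isomorphism `f` between substructures with fewer than
`k` elements extends to any further point `a`. -/
def HasKElimination (k : ℕ) : Prop :=
  ∀ f : M ≃ₚ[τ] M, (f.dom : Set M).encard < k → ∀ a : M, ∃ g : M ≃ₚ[τ] M, f ≤ g ∧ a ∈ g.dom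

/-- `n`, a number of equivalence classes, is large with respect to the bound `T`: it alone
makes a family of that many sets exceed the resources. -/
def Clock.IsLarge (ι : Clock) (T n : ℕ∞) : Prop :=
  match ι with
  | .iota2 => T ≤ n
  | .iota3 => T ≤ n
  | .iota4 => T < n

/-- Every equivalence relation on `m`-tuples, `m ≤ s`, that is defined by a quantifier-free formula
(without parameters) has a large number of classes, or each of its classes is the set of
realizations of a quantifier-free type over the empty set, that is, of a (not necessarily
complete) set of quantifier-free formulas. -/
def Dichotomy (s : ℕ) (large : ℕ∞ → Prop) : Prop :=
  ∀ m ≤ s, ∀ φ : τ.Formula (Fin m ⊕ Fin m), φ.IsQF →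
    ∀ E : Setoid (Fin m → M), (∀ a b, E a b ↔ φ.Realize (Sum.elim a b)) →
      large (ENat.card (Quotient E)) ∨
        ∀ a, ∃ p : Set (τ.Formula (Fin m)), (∀ θ ∈ p, θ.IsQF) ∧
          ∀ b, E a b ↔ ∀ θ ∈ p, θ.Realize b

/-- Every substructure of `M` with at most `k` elements embeds in `M'`; in other words, every
quantifier-free type in at most `k` variables that is realized in `M` is realized in `M'`. -/
def SmallSubstructuresEmbed (k : ℕ) (M' : Type*) [τ.Structure M'] : Prop :=
  ∀ A : τ.Substructure M, (A : Set M).encard ≤ k → Nonempty (A ↪[τ] M')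

end Models

end ChoicelessPTime

open FirstOrder ChoicelessPTime

/-! A computation that stays within its bound can only form sets that do not distinguish individual
atoms. Fix the set parameters of a formula `ψ_i` and let its atom parameters vary. Two atom tuples
are equivalent if they define the same set. By back and forth this relation respects quantifier-free
types, so it is quantifier-free definable. If it has many classes, the step overflows. Otherwise the
dichotomy makes each class the set of realizations of a type, so tuples of the same type define the
same set. This is `State.homogeneous_of_dichotomy`.

The sets occurring at time `t` in the two models can therefore be matched by a bijection `G` such
that atoms with the same quantifier-free 1-type belong to matched sets simultaneously (`Sim`).
Together with the small partial isomorphisms between the atoms, `G` is a back-and-forth system, so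
formulas whose subformulas have at most `s` free variables are preserved (`Sim.realize_iff`).
Matched parameters then define matched sets (`Sim.good_familySet`), and similarity passes to the
next state (`Sim.next`).

Homogeneity is needed in one of the two models only, and the dichotomy is applied in the one that
does not stop first. It has not overflowed before the earlier stopping time `t`, so the states at
`t` are similar. If the stopping times differ, halting of the first computation would transfer to
the other, so the first one overflowed without halting and its truth value is undefined. If they
agree, both halting and the truth of `χ` transfer. -/

namespace ChoicelessPTime

/-! ### Partial isomorphisms as relations -/

section PartialIsomorphisms

open FirstOrder.Language

variable {τ : FirstOrder.Language.{u, v}} {M₁ M₂ M₃ : Type*}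
  [τ.Structure M₁] [τ.Structure M₂] [τ.Structure M₃]

variable (τ) in
/-- The relation `h` is the graph of a partial isomorphism of `τ`-structures. -/
structure PIso (h : Set (M₁ × M₂)) : Prop where
  eq_iff : ∀ p ∈ h, ∀ q ∈ h, p.1 = q.1 ↔ p.2 = q.2
  rel_iff : ∀ (n : ℕ) (R : τ.Relations n) (p : Fin n → M₁ × M₂), (∀ i, p i ∈ h) →
    (Structure.RelMap R (fun i => (p i).1) ↔ Structure.RelMap R fun i => (p i).2)

/-- The composition of two relations, as sets of pairs. -/
def relComp (h : Set (M₁ × M₂)) (h' : Set (M₂ × M₃)) : Set (M₁ × M₃) :=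
  {p | ∃ y, (p.1, y) ∈ h ∧ (y, p.2) ∈ h'}

theorem PIso.mono {h h' : Set (M₁ × M₂)} (H : PIso τ h') (hh : h ⊆ h') : PIso τ h :=
  ⟨fun p hp q hq => H.eq_iff p (hh hp) q (hh hq),
    fun n R p hp => H.rel_iff n R p fun i => hh (hp i)⟩

theorem PIso.swap {h : Set (M₁ × M₂)} (H : PIso τ h) : PIso τ (Prod.swap ⁻¹' h) :=
  ⟨fun p hp q hq => (H.eq_iff p.swap hp q.swap hq).symm,
    fun n R p hp => (H.rel_iff n R (fun i => (p i).swap) hp).symm⟩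

theorem PIso.comp {h : Set (M₁ × M₂)} {h' : Set (M₂ × M₃)} (H : PIso τ h) (H' : PIso τ h') :
    PIso τ (relComp h h') := by
  refine ⟨?_, ?_⟩
  · rintro p ⟨y, hy, hy'⟩ q ⟨z, hz, hz'⟩
    exact (H.eq_iff _ hy _ hz).trans (H'.eq_iff _ hy' _ hz')
  · intro n R p hp
    choose y hy hy' using hp
    exact (H.rel_iff n R _ hy).trans (H'.rel_iff n R _ hy')

theorem PIso.encard_fst_image {h : Set (M₁ × M₂)} (H : PIso τ h) :
    (Prod.fst '' h).encard = h.encard :=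
  Set.InjOn.encard_image fun p hp q hq e => Prod.ext e ((H.eq_iff p hp q hq).1 e)

theorem PIso.encard_snd_image {h : Set (M₁ × M₂)} (H : PIso τ h) :
    (Prod.snd '' h).encard = h.encard :=
  Set.InjOn.encard_image fun p hp q hq e => Prod.ext ((H.eq_iff p hp q hq).2 e) e

/-- In a relational language, every partial isomorphism is an isomorphism of substructures. -/
theorem PIso.exists_partialEquiv [τ.IsRelational] {h : Set (M₁ × M₂)} (H : PIso τ h) :
    ∃ f : M₁ ≃ₚ[τ] M₂, (f.dom : Set M₁) = Prod.fst '' h ∧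
      ∀ p ∈ h, ∀ hp : p.1 ∈ f.dom, (f.toEquiv ⟨p.1, hp⟩ : M₂) = p.2 := by
  let A : τ.Substructure M₁ := ⟨Prod.fst '' h, fun f => isEmptyElim f⟩
  let B : τ.Substructure M₂ := ⟨Prod.snd '' h, fun f => isEmptyElim f⟩
  have hA : ∀ x : A, ∃ y : B, ((x : M₁), (y : M₂)) ∈ h := by
    rintro ⟨_, p, hp, rfl⟩
    exact ⟨⟨p.2, p, hp, rfl⟩, hp⟩
  choose F hF using hA
  have hbij : Function.Bijective F := by
    refine ⟨fun x x' e => Subtype.ext ?_, ?_⟩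
    · exact (H.eq_iff _ (hF x) _ (hF x')).2 (congrArg Subtype.val e)
    · rintro ⟨_, p, hp, rfl⟩
      refine ⟨⟨p.1, p, hp, rfl⟩, Subtype.ext ?_⟩
      exact (H.eq_iff _ (hF ⟨p.1, p, hp, rfl⟩) p hp).1 rfl
  refine ⟨⟨A, B, ⟨Equiv.ofBijective F hbij, fun f => isEmptyElim f, ?_⟩⟩, rfl, ?_⟩
  · intro n R x
    exact (H.rel_iff n R (fun i => ((x i : M₁), (F (x i) : M₂))) fun i => hF (x i)).symm
  · intro p hp hp'
    exact (H.eq_iff _ (hF ⟨p.1, hp'⟩) p hp).1 rfl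

theorem PIso.of_partialEquiv (f : M₁ ≃ₚ[τ] M₂) :
    PIso τ {p : M₁ × M₂ | ∃ hp : p.1 ∈ f.dom, (f.toEquiv ⟨p.1, hp⟩ : M₂) = p.2} := by
  refine ⟨?_, ?_⟩
  · rintro p ⟨hp, hp'⟩ q ⟨hq, hq'⟩
    simp [← hp', ← hq', Subtype.ext_iff.symm]
  · intro n R p hp
    choose hp hp' using hp
    have := f.toEquiv.map_rel R (fun i => ⟨(p i).1, hp i⟩)
    simp only [← hp']
    exact this.symm

theorem PIso.of_embedding {A : τ.Substructure M₁} (e : A ↪[τ] M₂) :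
    PIso τ {p : M₁ × M₂ | ∃ hp : p.1 ∈ A, e ⟨p.1, hp⟩ = p.2} := by
  refine ⟨?_, ?_⟩
  · rintro p ⟨hp, hp'⟩ q ⟨hq, hq'⟩
    simp [← hp', ← hq']
  · intro n R p hp
    choose hp hp' using hp
    have := e.map_rel R (fun i => ⟨(p i).1, hp i⟩)
    simp only [← hp']
    exact this.symm

variable [τ.IsRelational]

theorem HasKElimination.exists_insert {k : ℕ} (hM : HasKElimination τ M₁ k)
    {h : Set (M₁ × M₁)} (H : PIso τ h) (hk : h.encard < k) (a : M₁) :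
    ∃ b, PIso τ (insert (a, b) h) := by
  obtain ⟨f, hf, hf'⟩ := H.exists_partialEquiv
  obtain ⟨g, hfg, ha⟩ := hM f (by rwa [hf, H.encard_fst_image]) a
  refine ⟨g.toEquiv ⟨a, ha⟩, (PIso.of_partialEquiv g).mono ?_⟩
  rintro p (rfl | hp)
  · exact ⟨ha, rfl⟩
  · have hd : p.1 ∈ f.dom := by
      have : p.1 ∈ (f.dom : Set M₁) := hf ▸ ⟨p, hp, rfl⟩
      exact this
    refine ⟨PartialEquiv.dom_le_dom hfg hd, ?_⟩
    rw [← hf' p hp hd]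
    exact congrArg Subtype.val (PartialEquiv.toEquiv_inclusion_apply hfg ⟨p.1, hd⟩)

/-- An embedding `e` into `M₂` of the domain of `h` together with `a` need not agree with `h`. The
correction `h ∘ e⁻¹` is a partial isomorphism of `M₂` with itself, and `k`-elimination extends it to
`e a`. -/
theorem PIso.exists_insert {k : ℕ} (hM : HasKElimination τ M₂ k)
    (hemb : SmallSubstructuresEmbed τ M₁ k M₂) {h : Set (M₁ × M₂)} (H : PIso τ h)
    (hk : h.encard < k) (a : M₁) : ∃ b, PIso τ (insert (a, b) h) := by
  let A : τ.Substructure M₁ := ⟨insert a (Prod.fst '' h), fun f => isEmptyElim f⟩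
  have hA : (A : Set M₁).encard ≤ k := by
    refine (Set.encard_insert_le _ _).trans ?_
    rw [H.encard_fst_image]
    exact Order.add_one_le_of_lt hk
  obtain ⟨e⟩ := hemb A hA
  have He := PIso.of_embedding e
  set g : Set (M₁ × M₂) := {p | ∃ hp : p.1 ∈ A, e ⟨p.1, hp⟩ = p.2}
  have haA : a ∈ A := Set.mem_insert _ _
  have hhA : ∀ p ∈ h, p.1 ∈ A := fun p hp => Set.mem_insert_of_mem _ ⟨p, hp, rfl⟩
  let c : Set (M₂ × M₂) := relComp (Prod.swap ⁻¹' g) h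
  have hc : PIso τ c := He.swap.comp H
  have hck : c.encard < k := by
    refine lt_of_le_of_lt ?_ hk
    rw [← hc.encard_snd_image, ← H.encard_snd_image]
    refine Set.encard_le_encard ?_
    rintro _ ⟨p, ⟨y, _, hy⟩, rfl⟩
    exact ⟨_, hy, rfl⟩
  obtain ⟨b, hb⟩ := hM.exists_insert hc hck (e ⟨a, haA⟩)
  refine ⟨b, (He.comp hb).mono ?_⟩
  rintro p (rfl | hp)
  · exact ⟨e ⟨a, haA⟩, ⟨haA, rfl⟩, Or.inl rfl⟩
  · exact ⟨e ⟨p.1, hhA p hp⟩, ⟨hhA p hp, rfl⟩, Or.inr ⟨p.1, ⟨hhA p hp, rfl⟩, hp⟩⟩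

end PartialIsomorphisms

/-! ### Relations all of whose small subsets are partial isomorphisms -/

section LocalPartialIsomorphisms

open FirstOrder.Language

variable {τ : FirstOrder.Language.{u, v}} {M₁ M₂ M₃ : Type*}
  [τ.Structure M₁] [τ.Structure M₂] [τ.Structure M₃] {k s : ℕ}

variable (τ k) in
/-- Every subset of `h` with at most `k` elements is a partial isomorphism. -/
def LPIso (h : Set (M₁ × M₂)) : Prop :=
  ∀ h₀ ⊆ h, h₀.encard ≤ k → PIso τ h₀

theorem PIso.lpIso {h : Set (M₁ × M₂)} (H : PIso τ h) : LPIso τ k h :=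
  fun _ h₀ _ => H.mono h₀

theorem LPIso.mono {h h' : Set (M₁ × M₂)} (H : LPIso τ k h') (hh : h ⊆ h') : LPIso τ k h :=
  fun h₀ hh₀ => H h₀ (hh₀.trans hh)

theorem LPIso.pIso {h : Set (M₁ × M₂)} (H : LPIso τ k h) (hk : h.encard ≤ k) : PIso τ h :=
  H h subset_rfl hk

theorem encard_swap_preimage (h : Set (M₁ × M₂)) : (Prod.swap ⁻¹' h).encard = h.encard := by
  rw [← Set.image_swap_eq_preimage_swap, Prod.swap_injective.encard_image]

theorem LPIso.swap {h : Set (M₁ × M₂)} (H : LPIso τ k h) : LPIso τ k (Prod.swap ⁻¹' h) := by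
  intro h₀ hh₀ hk
  have := (H (Prod.swap ⁻¹' h₀) (fun p hp => by simpa using hh₀ hp)
    (by rwa [encard_swap_preimage])).swap
  simpa [← Set.preimage_comp] using this

variable (τ k s M₁ M₂) in
/-- The back-and-forth property for relations with at most `2 * s` elements. -/
structure BackForth : Prop where
  forth : ∀ h : Set (M₁ × M₂), LPIso τ k h → h.encard ≤ (2 * s : ℕ) → ∀ a,
    ∃ b, LPIso τ k (insert (a, b) h)
  back : ∀ h : Set (M₁ × M₂), LPIso τ k h → h.encard ≤ (2 * s : ℕ) → ∀ b,
    ∃ a, LPIso τ k (insert (a, b) h)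
  empty : PIso τ (∅ : Set (M₁ × M₂))

theorem BackForth.symm (H : BackForth τ M₁ M₂ k s) : BackForth τ M₂ M₁ k s := by
  refine ⟨fun h hh hc a => ?_, fun h hh hc a => ?_, by simpa using H.empty.swap⟩
  · obtain ⟨b, hb⟩ := H.back _ hh.swap (by rwa [encard_swap_preimage]) a
    exact ⟨b, hb.swap.mono (by rintro p (rfl | hp); exacts [Or.inl rfl, Or.inr hp])⟩
  · obtain ⟨b, hb⟩ := H.forth _ hh.swap (by rwa [encard_swap_preimage]) a
    exact ⟨b, hb.swap.mono (by rintro p (rfl | hp); exacts [Or.inl rfl, Or.inr hp])⟩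

/-- Points are added one at a time. The bound is `2 * s + 1` because the last extension may start
from `2 * s` pairs. -/
theorem BackForth.exists_tuple (H : BackForth τ M₁ M₂ k s) {h : Set (M₁ × M₂)}
    (hh : LPIso τ k h) {c : ℕ} (hc : h.encard ≤ c) :
    ∀ (n : ℕ) (_ : c + n ≤ 2 * s + 1) (x : Fin n → M₁), ∃ (y : Fin n → M₂) (h' : Set (M₁ × M₂)),
      h ⊆ h' ∧ (∀ i, (x i, y i) ∈ h') ∧ h'.encard ≤ (c + n : ℕ) ∧ LPIso τ k h'
  | 0, _, x => ⟨fun i => i.elim0, h, subset_rfl, fun i => i.elim0, by simpa using hc, hh⟩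
  | n + 1, hn, x => by
    obtain ⟨y, h', hsub, hxy, hc', hh'⟩ :=
      H.exists_tuple hh hc n (by omega) (fun i => x i.castSucc)
    obtain ⟨b, hb⟩ := H.forth h' hh' (hc'.trans (by exact_mod_cast (by omega))) (x (Fin.last n))
    refine ⟨Fin.snoc y b, _, hsub.trans (Set.subset_insert _ _), fun i => ?_,
      (Set.encard_insert_le _ _).trans ?_, hb⟩
    · refine Fin.lastCases ?_ (fun i => ?_) i
      · simp
      · simpa using Or.inr (hxy i)
    · calc h'.encard + 1 ≤ (c + n : ℕ) + 1 := by gcongr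
        _ = (c + (n + 1) : ℕ) := by push_cast; ring

theorem BackForth.of_kElimination [τ.IsRelational] [Nonempty M₁] [Nonempty M₂] (hsk : 3 * s ≤ k)
    (helim₁ : HasKElimination τ M₁ k) (helim₂ : HasKElimination τ M₂ k)
    (h₁₂ : SmallSubstructuresEmbed τ M₁ k M₂) (h₂₁ : SmallSubstructuresEmbed τ M₂ k M₁) :
    BackForth τ M₁ M₂ k s := by
  have hempty : PIso τ (∅ : Set (M₁ × M₂)) := by
    obtain ⟨e⟩ := h₁₂ ⟨∅, fun f => isEmptyElim f⟩ (Set.encard_empty.trans_le zero_le)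
    exact (PIso.of_embedding e).mono (Set.empty_subset _)
  -- For `k = 0` elimination gives nothing, but then `s = 0` and every relation is `LPIso`. For `k >
  -- 0` the hypothesis `3 * s ≤ k` yields `2 * s < k`, so the relations to be extended are genuine
  -- partial isomorphisms.
  rcases Nat.eq_zero_or_pos k with rfl | hk
  · have key : ∀ h : Set (M₁ × M₂), LPIso τ 0 h := by
      intro h h₀ _ hk
      have : h₀ = ∅ := by simpa using hk
      rwa [this]
    exact ⟨fun h _ _ a => ⟨Classical.arbitrary _, key _⟩,
      fun h _ _ a => ⟨Classical.arbitrary _, key _⟩, hempty⟩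
  · have hlt : ∀ {c : ℕ∞}, c ≤ (2 * s : ℕ) → c < k := fun hc =>
      lt_of_le_of_lt hc (by exact_mod_cast (by omega))
    refine ⟨fun h hh hc a => ?_, fun h hh hc b => ?_, hempty⟩
    · obtain ⟨b, hb⟩ := (hh.pIso (hlt hc).le).exists_insert helim₂ h₁₂ (hlt hc) a
      exact ⟨b, hb.lpIso⟩
    · obtain ⟨a, ha⟩ := (hh.pIso (hlt hc).le).swap.exists_insert helim₁ h₂₁
        (by rw [encard_swap_preimage]; exact hlt hc) b
      exact ⟨a, (ha.swap.mono (by rintro p (rfl | hp); exacts [Or.inl rfl, Or.inr hp])).lpIso⟩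

end LocalPartialIsomorphisms

/-! ### Quantifier-free formulas and types -/

section QuantifierFree

open FirstOrder.Language

variable {τ : FirstOrder.Language.{u, v}} {M₁ M₂ : Type*}
  [τ.Structure M₁] [τ.Structure M₂] {ι : Type*}

theorem exists_var_eq [τ.IsRelational] {α : Type*} (t : τ.Term α) : ∃ i, t = .var i := by
  cases t with
  | var i => exact ⟨i, rfl⟩
  | func f _ => exact isEmptyElim f

theorem PIso.realize_qf_iff [τ.IsRelational] {x : ι → M₁} {y : ι → M₂}
    (H : PIso τ (Set.range fun i => (x i, y i))) {θ : τ.Formula ι} (hθ : θ.IsQF) :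
    θ.Realize x ↔ θ.Realize y := by
  have hmem : ∀ i : ι ⊕ Fin 0, (Sum.elim x default i, Sum.elim y default i) ∈
      Set.range fun i => (x i, y i) := by
    rintro (i | i)
    · exact ⟨i, rfl⟩
    · exact i.elim0
  unfold Formula.Realize
  induction hθ with
  | falsum => exact Iff.rfl
  | of_isAtomic h =>
    cases h with
    | equal t₁ t₂ =>
      obtain ⟨i, rfl⟩ := exists_var_eq t₁
      obtain ⟨j, rfl⟩ := exists_var_eq t₂
      simpa [Term.bdEqual, BoundedFormula.Realize] using H.eq_iff _ (hmem i) _ (hmem j)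
    | rel R ts =>
      choose i hi using fun j => exists_var_eq (ts j)
      obtain rfl : ts = fun j => .var (i j) := funext hi
      simpa [Relations.boundedFormula, BoundedFormula.Realize] using
        H.rel_iff _ R _ fun j => hmem (i j)
  | imp _ _ h₁ h₂ => simp only [BoundedFormula.realize_imp, h₁, h₂]

theorem exists_qf_of_not_pIso {x : ι → M₁} {y : ι → M₂}
    (H : ¬ PIso τ (Set.range fun i => (x i, y i))) :
    ∃ θ : τ.Formula ι, θ.IsQF ∧ θ.Realize x ∧ ¬ θ.Realize y := by
  suffices h : ∃ θ : τ.Formula ι, θ.IsQF ∧ ¬ (θ.Realize x ↔ θ.Realize y) by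
    obtain ⟨θ, hθ, hne⟩ := h
    by_cases hx : θ.Realize x
    · exact ⟨θ, hθ, hx, fun hy => hne (iff_of_true hx hy)⟩
    · refine ⟨θ.not, hθ.not, by simpa using hx, fun hy => ?_⟩
      exact hne (iff_of_false hx (by simpa using hy))
  by_contra! hall
  refine H ⟨?_, ?_⟩
  · rintro _ ⟨i, rfl⟩ _ ⟨j, rfl⟩
    simpa using hall ((Term.var i).equal (Term.var j))
      (BoundedFormula.IsAtomic.equal _ _).isQF
  · intro n R p hp
    choose j hj using hp
    obtain rfl : p = fun i => (x (j i), y (j i)) := funext fun i => (hj i).symm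
    simpa using hall (R.formula fun i => Term.var (j i))
      (BoundedFormula.IsAtomic.rel _ _).isQF

theorem isQF_iSup {β : Type*} [Finite β] {f : β → τ.Formula ι} (hf : ∀ b, (f b).IsQF) :
    (Formula.iSup f).IsQF := by
  unfold Formula.iSup BoundedFormula.iSup
  let _ := Fintype.ofFinite β
  change BoundedFormula.IsQF (List.foldr _ _ (List.map f (Finset.univ : Finset β).toList))
  induction (Finset.univ : Finset β).toList with
  | nil => exact .falsum
  | cons b l ih => exact (hf b).sup ih

theorem isQF_iInf {β : Type*} [Finite β] {f : β → τ.Formula ι} (hf : ∀ b, (f b).IsQF) :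
    (Formula.iInf f).IsQF := by
  unfold Formula.iInf BoundedFormula.iInf
  let _ := Fintype.ofFinite β
  change BoundedFormula.IsQF (List.foldr _ _ (List.map f (Finset.univ : Finset β).toList))
  induction (Finset.univ : Finset β).toList with
  | nil => exact .top
  | cons b l ih => exact (hf b).inf ih

/-- On a finite structure, a relation that respects quantifier-free types is definable by a
quantifier-free formula. -/
theorem exists_qf_of_invariant [Finite M₁] [Finite ι] (R : (ι → M₁) → Prop)
    (hR : ∀ x y, PIso τ (Set.range fun i => (x i, y i)) → R x → R y) :
    ∃ φ : τ.Formula ι, φ.IsQF ∧ ∀ x, R x ↔ φ.Realize x := by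
  have hsep : ∀ (x : {x // R x}) (y : {y // ¬ R y}),
      ∃ θ : τ.Formula ι, θ.IsQF ∧ θ.Realize x.1 ∧ ¬ θ.Realize y.1 := fun x y =>
    exists_qf_of_not_pIso fun H => y.2 (hR _ _ H x.2)
  choose θ hqf hx hy using hsep
  -- There are finitely many tuples, so the disjunction over tuples in `R` of the conjunction over
  -- tuples outside `R` is a formula.
  refine ⟨Formula.iSup fun x => Formula.iInf fun y => θ x y,
    isQF_iSup fun x => isQF_iInf fun y => hqf x y, fun z => ?_⟩
  simp only [Formula.realize_iSup, Formula.realize_iInf]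
  refine ⟨fun hz => ⟨⟨z, hz⟩, fun y => hx _ _⟩, ?_⟩
  rintro ⟨x, h⟩
  by_contra hz
  exact hy x ⟨z, hz⟩ (h _)

end QuantifierFree

/-! ### The levels of the cumulative hierarchy -/

section Levels

variable {M : Type*} {t : ℕ}

theorem V.finite [Finite M] (t : ℕ) : Finite (V M t) := by
  induction t with
  | zero => exact inferInstanceAs (Finite M)
  | succ t ih => exact inferInstanceAs (Finite (M ⊕ Set (V M t)))

theorem V.atom_injective : ∀ t, Function.Injective (V.atom (M := M) t)
  | 0 => fun _ _ h => h
  | _ + 1 => fun _ _ h => Sum.inl_injective h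

theorem V.ofSet_injective : Function.Injective (V.ofSet (M := M) (t := t)) :=
  Sum.inr_injective

theorem V.ofSet_ne_atom (X : Set (V M t)) (a : M) : V.ofSet X ≠ V.atom (t + 1) a :=
  Sum.inr_ne_inl

theorem V.lift_atom : ∀ (t : ℕ) (a : M), V.lift t (V.atom t a) = V.atom (t + 1) a
  | 0, _ => rfl
  | _ + 1, _ => rfl

theorem V.lift_eq_ofSet : ∀ {t : ℕ} {x : V M t}, (∀ a, x ≠ V.atom t a) →
    V.lift t x = V.ofSet {z | V.Mem t z x}
  | 0, x, h => absurd rfl (h x)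
  | _ + 1, Sum.inl a, h => absurd rfl (h a)
  | _ + 1, Sum.inr _, _ => rfl

theorem V.lift_injective : ∀ t, Function.Injective (V.lift (M := M) t)
  | 0 => Sum.inl_injective
  | t + 1 => by
    rintro (a | X) (b | Y) h
    · exact congrArg Sum.inl (Sum.inl_injective h)
    · exact absurd h Sum.inl_ne_inr
    · exact absurd h Sum.inr_ne_inl
    · exact congrArg Sum.inr ((V.lift_injective t).image_injective (Sum.inr_injective h))

theorem V.lift_eq_atom {x : V M t} {a : M} (h : V.lift t x = V.atom (t + 1) a) :
    x = V.atom t a :=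
  V.lift_injective t (h.trans (V.lift_atom t a).symm)

theorem V.mem_ofSet {X : Set (V M t)} {y : V M (t + 1)} :
    V.Mem (t + 1) y (V.ofSet X) ↔ ∃ z ∈ X, V.lift t z = y := Iff.rfl

theorem V.not_mem_atom : ∀ {t : ℕ} {y : V M t} {a : M}, ¬ V.Mem t y (V.atom t a)
  | 0, _, _ => id
  | _ + 1, _, _ => id

end Levels

/-! ### Similar states -/

section Similarity

open FirstOrder.Language

variable {τ : FirstOrder.Language.{u, v}} {M₁ M₂ : Type*}
  [τ.Structure M₁] [τ.Structure M₂] {k s m t : ℕ}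

/-- The pairs in `G` together with the pairs of atoms that are related by `h`. -/
def withAtoms (G : Set (V M₁ t × V M₂ t)) (h : Set (M₁ × M₂)) : Set (V M₁ t × V M₂ t) :=
  G ∪ Prod.map (V.atom t) (V.atom t) '' h

variable (τ k) in
/-- The pairs in `G` together with all pairs of atoms that have the same quantifier-free type. -/
def withSimilarAtoms (G : Set (V M₁ t × V M₂ t)) : Set (V M₁ t × V M₂ t) :=
  withAtoms G {p | LPIso τ k {p}}

variable (τ k) in
/-- Two states are similar by means of a bijection `G` between their sets. -/
structure Sim (S₁ : State M₁ m t) (S₂ : State M₂ m t) (G : Set (V M₁ t × V M₂ t)) : Prop where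
  atom_mem_fst : ∀ a, V.atom t a ∈ S₁.N
  atom_mem_snd : ∀ a, V.atom t a ∈ S₂.N
  fst_mem : ∀ p ∈ G, p.1 ∈ S₁.N
  snd_mem : ∀ p ∈ G, p.2 ∈ S₂.N
  fst_ne_atom : ∀ p ∈ G, ∀ a, p.1 ≠ V.atom t a
  snd_ne_atom : ∀ p ∈ G, ∀ a, p.2 ≠ V.atom t a
  total : ∀ x ∈ S₁.N, (∃ a, x = V.atom t a) ∨ ∃ y, (x, y) ∈ G
  surj : ∀ y ∈ S₂.N, (∃ a, y = V.atom t a) ∨ ∃ x, (x, y) ∈ G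
  eq_iff : ∀ p ∈ G, ∀ q ∈ G, p.1 = q.1 ↔ p.2 = q.2
  trans_fst : ∀ x ∈ S₁.N, ∀ z, V.Mem t z x → z ∈ S₁.N
  trans_snd : ∀ x ∈ S₂.N, ∀ z, V.Mem t z x → z ∈ S₂.N
  pred_iff : ∀ p ∈ G, ∀ l, p.1 ∈ S₁.P l ↔ p.2 ∈ S₂.P l
  atom_notMem_fst : ∀ l a, V.atom t a ∉ S₁.P l
  atom_notMem_snd : ∀ l a, V.atom t a ∉ S₂.P l
  mem_iff : ∀ p ∈ withSimilarAtoms τ k G, ∀ q ∈ G, V.Mem t p.1 q.1 ↔ V.Mem t p.2 q.2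

theorem withAtoms_mono {G : Set (V M₁ t × V M₂ t)} {h h' : Set (M₁ × M₂)} (hh : h ⊆ h') :
    withAtoms G h ⊆ withAtoms G h' :=
  Set.union_subset_union_right _ (Set.image_mono hh)

theorem atom_mem_withAtoms {G : Set (V M₁ t × V M₂ t)} {h : Set (M₁ × M₂)} {a : M₁} {b : M₂}
    (hab : (a, b) ∈ h) : (V.atom t a, V.atom t b) ∈ withAtoms G h :=
  Or.inr ⟨(a, b), hab, rfl⟩

theorem withAtoms_subset_withSimilarAtoms {G : Set (V M₁ t × V M₂ t)} {h : Set (M₁ × M₂)}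
    (hh : LPIso τ k h) : withAtoms G h ⊆ withSimilarAtoms τ k G :=
  withAtoms_mono fun _ hp => hh.mono (Set.singleton_subset_iff.2 hp)

theorem swap_mem_withAtoms {G : Set (V M₁ t × V M₂ t)} {h : Set (M₁ × M₂)}
    {p : V M₂ t × V M₁ t} :
    p ∈ withAtoms (Prod.swap ⁻¹' G) (Prod.swap ⁻¹' h) ↔ p.swap ∈ withAtoms G h := by
  refine or_congr Iff.rfl ⟨?_, ?_⟩
  · rintro ⟨q, hq, rfl⟩
    exact ⟨q.swap, hq, rfl⟩
  · rintro ⟨q, hq, e⟩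
    exact ⟨q.swap, hq, by rw [← p.swap_swap, ← e]; rfl⟩

theorem swap_mem_withSimilarAtoms {G : Set (V M₁ t × V M₂ t)} {p : V M₂ t × V M₁ t}
    (hp : p ∈ withSimilarAtoms τ k (Prod.swap ⁻¹' G)) : p.swap ∈ withSimilarAtoms τ k G := by
  refine swap_mem_withAtoms.1 (withAtoms_mono ?_ hp)
  intro q hq
  have h := LPIso.swap (h := {q}) hq
  have e : Prod.swap ⁻¹' {q} = {q.swap} := by
    ext x
    simp [Prod.swap_eq_iff_eq_swap]
  rwa [e] at h

instance extLang_isRelational [τ.IsRelational] : (extLang τ m).IsRelational :=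
  fun n => inferInstanceAs (IsEmpty (τ.Functions n ⊕ Empty))

namespace Sim

variable {S₁ : State M₁ m t} {S₂ : State M₂ m t} {G : Set (V M₁ t × V M₂ t)}

theorem symm (H : Sim τ k S₁ S₂ G) : Sim τ k S₂ S₁ (Prod.swap ⁻¹' G) where
  atom_mem_fst := H.atom_mem_snd
  atom_mem_snd := H.atom_mem_fst
  fst_mem _ hp := H.snd_mem _ hp
  snd_mem _ hp := H.fst_mem _ hp
  fst_ne_atom _ hp := H.snd_ne_atom _ hp
  snd_ne_atom _ hp := H.fst_ne_atom _ hp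
  total := H.surj
  surj := H.total
  eq_iff _ hp _ hq := (H.eq_iff _ hp _ hq).symm
  trans_fst := H.trans_snd
  trans_snd := H.trans_fst
  pred_iff _ hp l := (H.pred_iff _ hp l).symm
  atom_notMem_fst := H.atom_notMem_snd
  atom_notMem_snd := H.atom_notMem_fst
  mem_iff _ hp _ hq := (H.mem_iff _ (swap_mem_withSimilarAtoms hp) _ hq).symm

theorem mem_of_mem_withAtoms (H : Sim τ k S₁ S₂ G) {h : Set (M₁ × M₂)}
    {p : V M₁ t × V M₂ t} (hp : p ∈ withAtoms G h) : p.1 ∈ S₁.N ∧ p.2 ∈ S₂.N := by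
  rcases hp with hp | ⟨q, -, rfl⟩
  · exact ⟨H.fst_mem _ hp, H.snd_mem _ hp⟩
  · exact ⟨H.atom_mem_fst _, H.atom_mem_snd _⟩

/-- A relation that matches the given elements can be chosen to be no larger than their number. -/
theorem exists_small {ι : Type*} {I : Set ι} {v : ι → V M₁ t} {v' : ι → V M₂ t}
    {h : Set (M₁ × M₂)} (hv : ∀ i ∈ I, (v i, v' i) ∈ withAtoms G h) :
    ∃ h₀ ⊆ h, h₀.encard ≤ I.encard ∧ ∀ i ∈ I, (v i, v' i) ∈ withAtoms G h₀ := by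
  let J : Set ι := {i ∈ I | (v i, v' i) ∈ Prod.map (V.atom t) (V.atom t) '' h}
  have hJ : ∀ j : J, ∃ q ∈ h, Prod.map (V.atom t) (V.atom t) q = (v j, v' j) := fun j => j.2.2
  choose q hq hq' using hJ
  refine ⟨Set.range q, Set.range_subset_iff.2 hq, ?_, fun i hi => ?_⟩
  · rw [← Set.image_univ]
    refine (Set.encard_image_le _ _).trans ?_
    rw [Set.encard_univ, ENat.card_coe_set_eq]
    exact Set.encard_le_encard fun i hi => hi.1
  · rcases hv i hi with h' | h'
    · exact Or.inl h'
    · exact Or.inr ⟨_, ⟨⟨i, hi, h'⟩, rfl⟩, hq' _⟩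

theorem eq_iff_of_withAtoms (H : Sim τ k S₁ S₂ G) {h : Set (M₁ × M₂)} (hh : PIso τ h)
    {p q : V M₁ t × V M₂ t} (hp : p ∈ withAtoms G h) (hq : q ∈ withAtoms G h) :
    p.1 = q.1 ↔ p.2 = q.2 := by
  rcases hp with hp | ⟨a, ha, rfl⟩ <;> rcases hq with hq | ⟨b, hb, rfl⟩
  · exact H.eq_iff p hp q hq
  · exact iff_of_false (H.fst_ne_atom p hp _) (H.snd_ne_atom p hp _)
  · exact iff_of_false (H.fst_ne_atom q hq _).symm (H.snd_ne_atom q hq _).symm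
  · exact ((V.atom_injective t).eq_iff.trans (hh.eq_iff a ha b hb)).trans
      (V.atom_injective t).eq_iff.symm

theorem exists_of_mem (H : Sim τ k S₁ S₂ G) (hbf : BackForth τ M₁ M₂ k s)
    {h : Set (M₁ × M₂)} (hh : LPIso τ k h) (hs : h.encard ≤ (2 * s : ℕ)) {x : V M₁ t}
    (hx : x ∈ S₁.N) : ∃ (y : V M₂ t) (h' : Set (M₁ × M₂)), y ∈ S₂.N ∧ h ⊆ h' ∧ LPIso τ k h' ∧
      (x, y) ∈ withAtoms G h' := by
  rcases H.total x hx with ⟨a, rfl⟩ | ⟨y, hy⟩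
  · obtain ⟨b, hb⟩ := hbf.forth h hh hs a
    exact ⟨V.atom t b, _, H.atom_mem_snd b, Set.subset_insert _ _, hb,
      atom_mem_withAtoms (Set.mem_insert _ _)⟩
  · exact ⟨y, h, H.snd_mem _ hy, subset_rfl, hh, Or.inl hy⟩

theorem exists_of_mem_snd (H : Sim τ k S₁ S₂ G) (hbf : BackForth τ M₁ M₂ k s)
    {h : Set (M₁ × M₂)} (hh : LPIso τ k h) (hs : h.encard ≤ (2 * s : ℕ)) {y : V M₂ t}
    (hy : y ∈ S₂.N) : ∃ (x : V M₁ t) (h' : Set (M₁ × M₂)), x ∈ S₁.N ∧ h ⊆ h' ∧ LPIso τ k h' ∧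
      (x, y) ∈ withAtoms G h' := by
  rcases H.surj y hy with ⟨a, rfl⟩ | ⟨x, hx⟩
  · obtain ⟨b, hb⟩ := hbf.back h hh hs a
    exact ⟨V.atom t b, _, H.atom_mem_fst b, Set.subset_insert _ _, hb,
      atom_mem_withAtoms (Set.mem_insert _ _)⟩
  · exact ⟨x, h, H.fst_mem _ hx, subset_rfl, hh, Or.inl hx⟩

theorem tauRel_iff {h : Set (M₁ × M₂)} (H : Sim τ k S₁ S₂ G) (hh : PIso τ h) {n : ℕ}
    (R : τ.Relations n) {x : Fin n → V M₁ t} {y : Fin n → V M₂ t}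
    (hxy : ∀ i, (x i, y i) ∈ withAtoms G h) :
    (∃ a : Fin n → M₁, (∀ i, x i = V.atom t (a i)) ∧ Structure.RelMap R a) ↔
      ∃ a : Fin n → M₂, (∀ i, y i = V.atom t (a i)) ∧ Structure.RelMap R a := by
  constructor
  · rintro ⟨a, ha, hR⟩
    have : ∀ i, ∃ p ∈ h, p.1 = a i ∧ y i = V.atom t p.2 := fun i => by
      rcases hxy i with h' | ⟨p, hp, e⟩
      · exact absurd (ha i) (H.fst_ne_atom _ h' _)
      · exact ⟨p, hp, V.atom_injective t ((congrArg Prod.fst e).trans (ha i)),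
          (congrArg Prod.snd e).symm⟩
    choose p hp hp₁ hp₂ using this
    obtain rfl : (fun i => (p i).1) = a := funext hp₁
    exact ⟨_, hp₂, (hh.rel_iff n R p hp).1 hR⟩
  · rintro ⟨a, ha, hR⟩
    have : ∀ i, ∃ p ∈ h, p.2 = a i ∧ x i = V.atom t p.1 := fun i => by
      rcases hxy i with h' | ⟨p, hp, e⟩
      · exact absurd (ha i) (H.snd_ne_atom _ h' _)
      · exact ⟨p, hp, V.atom_injective t ((congrArg Prod.snd e).trans (ha i)),
          (congrArg Prod.fst e).symm⟩
    choose p hp hp₁ hp₂ using this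
    obtain rfl : (fun i => (p i).2) = a := funext hp₁
    exact ⟨_, hp₂, (hh.rel_iff n R p hp).2 hR⟩

theorem mem_iff_of_withAtoms (H : Sim τ k S₁ S₂ G) {h : Set (M₁ × M₂)} (hh : LPIso τ k h)
    {p q : V M₁ t × V M₂ t} (hp : p ∈ withAtoms G h) (hq : q ∈ withAtoms G h) :
    V.Mem t p.1 q.1 ↔ V.Mem t p.2 q.2 := by
  rcases hq with hq | ⟨b, -, rfl⟩
  · exact H.mem_iff p (withAtoms_subset_withSimilarAtoms hh hp) q hq
  · exact iff_of_false V.not_mem_atom V.not_mem_atom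

theorem pred_iff_of_withAtoms (H : Sim τ k S₁ S₂ G) {h : Set (M₁ × M₂)}
    {p : V M₁ t × V M₂ t} (hp : p ∈ withAtoms G h) (l : Fin m) :
    p.1 ∈ S₁.P l ↔ p.2 ∈ S₂.P l := by
  rcases hp with hp | ⟨b, -, rfl⟩
  · exact H.pred_iff p hp l
  · exact iff_of_false (H.atom_notMem_fst _ _) (H.atom_notMem_snd _ _)

/-- Formulas all of whose subformulas have at most `s` free variables are preserved. -/
theorem realize_iff [τ.IsRelational] (H : Sim τ k S₁ S₂ G) (hbf : BackForth τ M₁ M₂ k s)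
    (hsk : s ≤ k) [Nonempty M₁] {α : Type*} {n : ℕ} (φ : (extLang τ m).BoundedFormula α n)
    (hφ : SubformulasHaveFewFreeVars s φ) {v : α → S₁.N} {xs : Fin n → S₁.N}
    {v' : α → S₂.N} {xs' : Fin n → S₂.N} {h : Set (M₁ × M₂)} (hh : LPIso τ k h)
    (hv : ∀ x ∈ freeVars φ,
      (((Sum.elim v xs x : S₁.N) : V M₁ t), ((Sum.elim v' xs' x : S₂.N) : V M₂ t)) ∈
        withAtoms G h) :
    letI := levelStructure (τ := τ) S₁.N S₁.P
    letI := levelStructure (τ := τ) S₂.N S₂.P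
    φ.Realize v xs ↔ φ.Realize v' xs' := by
  let := levelStructure (τ := τ) S₁.N S₁.P
  let := levelStructure (τ := τ) S₂.N S₂.P
  change φ.Realize v xs ↔ φ.Realize v' xs'
  induction φ generalizing h with
  | falsum => exact Iff.rfl
  | equal t₁ t₂ =>
    obtain ⟨h₀, hsub, hc, hv₀⟩ := exists_small hv
    obtain ⟨i, rfl⟩ := exists_var_eq t₁
    obtain ⟨j, rfl⟩ := exists_var_eq t₂
    -- At most `s ≤ k` pairs are relevant to an atomic formula, so the local hypothesis on `h`
    -- suffices.
    have hP := hh h₀ hsub (hc.trans (hφ.trans (by exact_mod_cast hsk)))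
    have := H.eq_iff_of_withAtoms hP (hv₀ i (by simp [freeVars])) (hv₀ j (by simp [freeVars]))
    simpa [BoundedFormula.Realize, Subtype.ext_iff] using this
  | rel R ts =>
    obtain ⟨h₀, hsub, hc, hv₀⟩ := exists_small hv
    choose i hi using fun j => exists_var_eq (ts j)
    obtain rfl : ts = fun j => .var (i j) := funext hi
    have hP := hh h₀ hsub (hc.trans (hφ.trans (by exact_mod_cast hsk)))
    have hv₁ := fun j => hv₀ (i j) (by simp [freeVars])
    rcases R with R | R
    · exact H.tauRel_iff hP R hv₁
    · cases R with
      | mem => exact H.mem_iff_of_withAtoms hP.lpIso (hv₁ 0) (hv₁ 1)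
      | pred l => exact H.pred_iff_of_withAtoms (hv₁ 0) l
  | imp f g ihf ihg =>
    rw [BoundedFormula.realize_imp, BoundedFormula.realize_imp,
      ihf hφ.2.1 hh fun x hx => hv x (Or.inl hx), ihg hφ.2.2 hh fun x hx => hv x (Or.inr hx)]
  | all f ih =>
    -- As in a pebble game, pairs that match no free variable are discarded before a quantifier is
    -- answered, so the relation to be extended has at most `s` pairs whatever the quantifier depth.
    obtain ⟨h₀, hsub, hc, hv₀⟩ := exists_small hv
    have hcs : h₀.encard ≤ (2 * s : ℕ) := (hc.trans hφ.1).trans (by exact_mod_cast (by omega))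
    have key : ∀ (x : S₁.N) (y : S₂.N) (h' : Set (M₁ × M₂)), h₀ ⊆ h' →
        ((x : V M₁ t), (y : V M₂ t)) ∈ withAtoms G h' → LPIso τ k h' →
        (f.Realize v (Fin.snoc xs x) ↔ f.Realize v' (Fin.snoc xs' y)) := by
      intro x y h' hsub' hxy hh'
      refine ih hφ.2 hh' ?_
      rintro (i | i) hi
      · exact withAtoms_mono hsub' (hv₀ (Sum.inl i) hi)
      · induction i using Fin.lastCases with
        | last => simpa using hxy
        | cast i => simpa using withAtoms_mono hsub' (hv₀ (Sum.inr i) hi)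
    rw [BoundedFormula.realize_all, BoundedFormula.realize_all]
    constructor
    · intro hall y
      obtain ⟨x, h', hx, hsub', hh', hxy⟩ := H.exists_of_mem_snd hbf (hh.mono hsub) hcs y.2
      exact (key ⟨x, hx⟩ y h' hsub' hxy hh').1 (hall _)
    · intro hall x
      obtain ⟨y, h', hy, hsub', hh', hxy⟩ := H.exists_of_mem hbf (hh.mono hsub) hcs x.2
      exact (key x ⟨y, hy⟩ h' hsub' hxy hh').2 (hall _)

end Sim

end Similarity

/-! ### The sets that are formed in one step -/

section OneStep

open FirstOrder.Language

variable {τ : FirstOrder.Language.{u, v}} {M M₁ M₂ : Type*}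
  [τ.Structure M] [τ.Structure M₁] [τ.Structure M₂] {k s t : ℕ}

/-- The elements of a state that are not atoms, paired with themselves. -/
def State.diag {m : ℕ} (S : State M m t) : Set (V M t × V M t) :=
  {p | p.1 = p.2 ∧ p.1 ∈ S.N ∧ ∀ a, p.1 ≠ V.atom t a}

variable (τ k) in
/-- A set in `S₁` and a set in `S₂` that are invariant under the pairs of similar elements. -/
structure Good {m : ℕ} (S₁ : State M₁ m t) (S₂ : State M₂ m t) (G : Set (V M₁ t × V M₂ t))
    (X₁ : Set (V M₁ t)) (X₂ : Set (V M₂ t)) : Prop where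
  subset_fst : X₁ ⊆ S₁.N
  subset_snd : X₂ ⊆ S₂.N
  mem_iff : ∀ p ∈ withSimilarAtoms τ k G, p.1 ∈ X₁ ↔ p.2 ∈ X₂

theorem LPIso.comp_singleton {M₃ : Type*} [τ.Structure M₃] {a : M₁} {b : M₂} {c : M₃}
    (h : LPIso τ k {(a, b)}) (h' : LPIso τ k {(b, c)}) : LPIso τ k {(a, c)} := by
  intro h₀ hsub hk
  rcases Set.subset_singleton_iff_eq.1 hsub with rfl | rfl
  · exact ((h ∅ (Set.empty_subset _) (by simp)).comp
      (h' ∅ (Set.empty_subset _) (by simp))).mono (Set.empty_subset _)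
  · refine ((h _ subset_rfl (by simpa using hk)).comp (h' _ subset_rfl (by simpa using hk))).mono ?_
    rintro _ rfl
    exact ⟨b, rfl, rfl⟩

namespace Sim

section

variable {m : ℕ} {S₁ : State M₁ m t} {S₂ : State M₂ m t} {G : Set (V M₁ t × V M₂ t)}

theorem exists_similar_fst (H : Sim τ k S₁ S₂ G) (hbf : BackForth τ M₁ M₂ k s) {x : V M₁ t}
    (hx : x ∈ S₁.N) : ∃ y, (x, y) ∈ withSimilarAtoms τ k G := by
  obtain ⟨y, h, -, -, hh, hxy⟩ := H.exists_of_mem hbf hbf.empty.lpIso (by simp) hx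
  exact ⟨y, withAtoms_subset_withSimilarAtoms hh hxy⟩

theorem exists_similar_snd (H : Sim τ k S₁ S₂ G) (hbf : BackForth τ M₁ M₂ k s) {y : V M₂ t}
    (hy : y ∈ S₂.N) : ∃ x, (x, y) ∈ withSimilarAtoms τ k G := by
  obtain ⟨x, h, -, -, hh, hxy⟩ := H.exists_of_mem_snd hbf hbf.empty.lpIso (by simp) hy
  exact ⟨x, withAtoms_subset_withSimilarAtoms hh hxy⟩

/-- Every element of either state has a similar partner in the other, so each member of a good pair
determines the other member. -/
theorem eq_iff_of_good (H : Sim τ k S₁ S₂ G) (hbf : BackForth τ M₁ M₂ k s)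
    {X₁ Y₁ : Set (V M₁ t)} {X₂ Y₂ : Set (V M₂ t)} (hX : Good τ k S₁ S₂ G X₁ X₂)
    (hY : Good τ k S₁ S₂ G Y₁ Y₂) : X₁ = Y₁ ↔ X₂ = Y₂ := by
  constructor
  · rintro rfl
    ext y
    by_cases hy : y ∈ S₂.N
    · obtain ⟨x, hx⟩ := H.exists_similar_snd hbf hy
      exact (hX.mem_iff _ hx).symm.trans (hY.mem_iff _ hx)
    · exact iff_of_false (fun h => hy (hX.subset_snd h)) fun h => hy (hY.subset_snd h)
  · rintro rfl
    ext x
    by_cases hx : x ∈ S₁.N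
    · obtain ⟨y, hy⟩ := H.exists_similar_fst hbf hx
      exact (hX.mem_iff _ hy).trans (hY.mem_iff _ hy).symm
    · exact iff_of_false (fun h => hx (hX.subset_fst h)) fun h => hx (hY.subset_fst h)

/-- A state that is similar to another one is similar to itself. -/
theorem diag (H : Sim τ k S₁ S₂ G) (hbf : BackForth τ M₁ M₂ k s) : Sim τ k S₂ S₂ S₂.diag where
  atom_mem_fst := H.atom_mem_snd
  atom_mem_snd := H.atom_mem_snd
  fst_mem _ hp := hp.2.1
  snd_mem _ hp := hp.1 ▸ hp.2.1
  fst_ne_atom _ hp := hp.2.2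
  snd_ne_atom _ hp := hp.1 ▸ hp.2.2
  total x hx := or_iff_not_imp_left.2 fun h => ⟨x, rfl, hx, not_exists.1 h⟩
  surj x hx := or_iff_not_imp_left.2 fun h => ⟨x, rfl, hx, not_exists.1 h⟩
  eq_iff _ hp _ hq := by rw [hp.1, hq.1]
  trans_fst := H.trans_snd
  trans_snd := H.trans_snd
  pred_iff _ hp l := by rw [hp.1]
  atom_notMem_fst := H.atom_notMem_snd
  atom_notMem_snd := H.atom_notMem_snd
  mem_iff := by
    rintro p hp ⟨X, Y⟩ ⟨hXY, hX, hXa⟩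
    obtain rfl : X = Y := hXY
    rcases hp with hp | ⟨⟨a, b⟩, hab, rfl⟩
    · rw [hp.1]
    · obtain ⟨Z, hZ⟩ := (H.surj X hX).resolve_left (not_exists.2 hXa)
      -- An atom `c` of the first model that is similar to `a` is also similar to `b`. Whether `a`
      -- and `b` belong to `X` is read off from whether `c` belongs to the partner `Z`.
      obtain ⟨c, hc⟩ := hbf.back ∅ hbf.empty.lpIso (by simp) a
      have hca : LPIso τ k {(c, a)} := hc.mono (by simp)
      exact (H.mem_iff _ (atom_mem_withAtoms hca) _ hZ).symm.trans
        (H.mem_iff _ (atom_mem_withAtoms (hca.comp_singleton hab)) _ hZ)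

/-- Similar states remain similar when the additional predicates are dropped. -/
theorem forget_predicates (H : Sim τ k S₁ S₂ G) :
    Sim τ k (⟨S₁.N, fun l => l.elim0⟩ : State M₁ 0 t) ⟨S₂.N, fun l => l.elim0⟩ G :=
  { H with
    pred_iff := fun _ _ l => l.elim0
    atom_notMem_fst := fun l => l.elim0
    atom_notMem_snd := fun l => l.elim0 }

/-- Every tuple in the first state can be matched by a tuple in the second state. -/
theorem exists_tuple (H : Sim τ k S₁ S₂ G) (hbf : BackForth τ M₁ M₂ k s) [Nonempty M₁]
    {h : Set (M₁ × M₂)} (hh : LPIso τ k h) {c n : ℕ} (hc : h.encard ≤ c) (hn : c + n ≤ 2 * s + 1)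
    (b : Fin n → S₁.N) : ∃ (b' : Fin n → S₂.N) (h' : Set (M₁ × M₂)), h ⊆ h' ∧ LPIso τ k h' ∧
      ∀ j, ((b j : V M₁ t), (b' j : V M₂ t)) ∈ withAtoms G h' := by
  have hx : ∀ j, ∃ a : M₁, (b j : V M₁ t) = V.atom t a ∨ ∃ y, ((b j : V M₁ t), y) ∈ G := by
    intro j
    rcases H.total _ (b j).2 with ⟨a, ha⟩ | hy
    · exact ⟨a, Or.inl ha⟩
    · exact ⟨Classical.arbitrary _, Or.inr hy⟩
  choose x hx using hx
  obtain ⟨y, h', hsub, hxy, -, hh'⟩ := hbf.exists_tuple hh hc n hn x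
  have hb : ∀ j, ∃ b' : S₂.N, ((b j : V M₁ t), (b' : V M₂ t)) ∈ withAtoms G h' := by
    intro j
    rcases hx j with ha | ⟨z, hz⟩
    · exact ⟨⟨V.atom t (y j), H.atom_mem_snd _⟩, by rw [ha]; exact atom_mem_withAtoms (hxy j)⟩
    · exact ⟨⟨z, H.snd_mem _ hz⟩, Or.inl hz⟩
  choose b' hb' using hb
  exact ⟨b', h', hsub, hh', hb'⟩

end

end Sim

variable [τ.IsRelational] {Υ : InductiveScheme τ}

/-- The set `{a ∈ N_t : N_t⁺ ⊨ ψ_i(a, b̄)}`. -/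
def State.familySet (S : State M Υ.m₁ t) (i : Fin Υ.m₀) (b : Fin (Υ.len i) → S.N) :
    Set (V M t) :=
  letI := levelStructure (τ := τ) S.N S.P
  Subtype.val '' {a : S.N | (Υ.ψ i).Realize (Sum.elim (fun _ => a) b)}

theorem State.familySet_subset (S : State M Υ.m₁ t) (i : Fin Υ.m₀) (b : Fin (Υ.len i) → S.N) :
    S.familySet i b ⊆ S.N := by
  rintro _ ⟨x, -, rfl⟩
  exact x.2

theorem State.c_subset (S : State M Υ.m₁ t) (l : Fin Υ.m₁) : S.c Υ l ⊆ S.N := by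
  rintro _ ⟨x, -, rfl⟩
  exact x.2

variable (k) in
/-- The set defined from a tuple of parameters depends only on the sets in the tuple and on the
quantifier-free type of the atoms in it. -/
def State.Homogeneous (S : State M Υ.m₁ t) : Prop :=
  ∀ (i : Fin Υ.m₀) (b b' : Fin (Υ.len i) → S.N) (h : Set (M × M)), LPIso τ k h →
    (∀ j, ((b j : V M t), (b' j : V M t)) ∈ withAtoms S.diag h) →
    S.familySet i b = S.familySet i b'

namespace Sim

section

variable {S₁ : State M₁ Υ.m₁ t} {S₂ : State M₂ Υ.m₁ t} {G : Set (V M₁ t × V M₂ t)}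

/-- The tested pair must be compatible with the relation that matches the parameters.
`good_familySet` removes this restriction. -/
theorem mem_familySet_iff (H : Sim τ k S₁ S₂ G) (hbf : BackForth τ M₁ M₂ k s) (hsk : s ≤ k)
    [Nonempty M₁] (hψ : ∀ i, SubformulasHaveFewFreeVars s (Υ.ψ i)) {i : Fin Υ.m₀}
    {b : Fin (Υ.len i) → S₁.N} {b' : Fin (Υ.len i) → S₂.N} {h : Set (M₁ × M₂)}
    (hh : LPIso τ k h) (hb : ∀ j, ((b j : V M₁ t), (b' j : V M₂ t)) ∈ withAtoms G h)
    {p : V M₁ t × V M₂ t} (hp : p ∈ withAtoms G h) :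
    p.1 ∈ S₁.familySet i b ↔ p.2 ∈ S₂.familySet i b' := by
  obtain ⟨hp₁, hp₂⟩ := H.mem_of_mem_withAtoms hp
  have := H.realize_iff hbf hsk (Υ.ψ i) (hψ i) (v := Sum.elim (fun _ => ⟨p.1, hp₁⟩) b)
    (v' := Sum.elim (fun _ => ⟨p.2, hp₂⟩) b') (xs := default) (xs' := default) hh (by
      rintro ((_ | j) | j) -
      · exact hp
      · exact hb j
      · exact j.elim0)
  constructor
  · rintro ⟨x, hx, e⟩
    obtain rfl : x = ⟨p.1, hp₁⟩ := Subtype.ext e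
    exact ⟨⟨p.2, hp₂⟩, this.1 hx, rfl⟩
  · rintro ⟨x, hx, e⟩
    obtain rfl : x = ⟨p.2, hp₂⟩ := Subtype.ext e
    exact ⟨⟨p.1, hp₁⟩, this.2 hx, rfl⟩

/-- Without parameters, a single similar pair is all that has to be matched, and no homogeneity is
needed. -/
theorem good_c (H : Sim τ k S₁ S₂ G) (hbf : BackForth τ M₁ M₂ k s) (hsk : s ≤ k)
    [Nonempty M₁] (hφ : ∀ l, SubformulasHaveFewFreeVars s (Υ.φ l)) (l : Fin Υ.m₁) :
    Good τ k S₁ S₂ G (S₁.c Υ l) (S₂.c Υ l) := by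
  refine ⟨S₁.c_subset l, S₂.c_subset l, fun p hp => ?_⟩
  obtain ⟨hp₁, hp₂⟩ := H.mem_of_mem_withAtoms hp
  obtain ⟨h, hh, hph⟩ : ∃ h, LPIso τ k h ∧ p ∈ withAtoms G h := by
    rcases hp with hp | ⟨q, hq, rfl⟩
    · exact ⟨∅, hbf.empty.lpIso, Or.inl hp⟩
    · exact ⟨_, hq, atom_mem_withAtoms rfl⟩
  have := H.realize_iff hbf hsk (Υ.φ l) (hφ l) (v := fun _ => ⟨p.1, hp₁⟩)
    (v' := fun _ => ⟨p.2, hp₂⟩) (xs := default) (xs' := default) hh (by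
      rintro (_ | j) -
      · exact hph
      · exact j.elim0)
  constructor
  · rintro ⟨x, hx, e⟩
    obtain rfl : x = ⟨p.1, hp₁⟩ := Subtype.ext e
    exact ⟨⟨p.2, hp₂⟩, this.1 hx, rfl⟩
  · rintro ⟨x, hx, e⟩
    obtain rfl : x = ⟨p.2, hp₂⟩ := Subtype.ext e
    exact ⟨⟨p.1, hp₁⟩, this.2 hx, rfl⟩

/-- A similar pair of atoms `(a, a')` may be incompatible with the matching of `b` and `b'`. So `b`
is matched afresh, over `(a, a')`, with a tuple `b''`. The tuples `b''` and `b'` have the same type,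
both being matched with `b`, and homogeneity of `S₂` makes them define the same set. -/
theorem good_familySet (H : Sim τ k S₁ S₂ G) (hbf : BackForth τ M₁ M₂ k s) (hsk : s ≤ k)
    [Nonempty M₁] (hψ : ∀ i, SubformulasHaveFewFreeVars s (Υ.ψ i)) (hlen : ∀ i, Υ.len i ≤ s)
    (hom : S₂.Homogeneous k) {i : Fin Υ.m₀}
    {b : Fin (Υ.len i) → S₁.N} {b' : Fin (Υ.len i) → S₂.N} {h : Set (M₁ × M₂)}
    (hh : LPIso τ k h) (hb : ∀ j, ((b j : V M₁ t), (b' j : V M₂ t)) ∈ withAtoms G h) :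
    Good τ k S₁ S₂ G (S₁.familySet i b) (S₂.familySet i b') := by
  refine ⟨S₁.familySet_subset i b, S₂.familySet_subset i b', fun p hp => ?_⟩
  rcases hp with hp | ⟨⟨a, a'⟩, haa, rfl⟩
  · exact H.mem_familySet_iff hbf hsk hψ hh hb (Or.inl hp)
  rcases Nat.eq_zero_or_pos (Υ.len i) with h0 | hpos
  · refine H.mem_familySet_iff hbf hsk hψ haa (fun j => ?_) (atom_mem_withAtoms rfl)
    exact (h0 ▸ j).elim0
  obtain ⟨b'', h', hsub, hh', hb''⟩ := H.exists_tuple hbf haa (c := 1) (n := Υ.len i) (by simp)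
    (by have := hlen i; omega) b
  refine (H.mem_familySet_iff hbf hsk hψ hh' hb'' (atom_mem_withAtoms (hsub rfl))).trans ?_
  suffices e : S₂.familySet i b'' = S₂.familySet i b' by rw [e]; rfl
  have hcard : (Set.univ : Set (Fin (Υ.len i))).encard ≤ k := by
    rw [Set.encard_univ, ENat.card_eq_coe_fintype_card, Fintype.card_fin]
    exact_mod_cast (hlen i).trans hsk
  obtain ⟨h₀, hsub₀, hc₀, hb₀⟩ := exists_small (I := Set.univ) fun j _ => hb j
  obtain ⟨h₁, hsub₁, hc₁, hb₁⟩ := exists_small (I := Set.univ) fun j _ => hb'' j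
  -- The composition leads from `b''` back to `b` and on to `b'`. Both relations are first cut down
  -- to at most `s ≤ k` pairs, to be partial isomorphisms.
  have hP := (hh' h₁ hsub₁ (hc₁.trans hcard)).swap.comp (hh h₀ hsub₀ (hc₀.trans hcard))
  refine hom i b'' b' _ hP.lpIso fun j => ?_
  rcases hb₀ j trivial with hG | ⟨q, hq, eq⟩ <;> rcases hb₁ j trivial with hG' | ⟨q', hq', eq'⟩
  · exact Or.inl ⟨(H.eq_iff _ hG' _ hG).1 rfl, (b'' j).2, H.snd_ne_atom _ hG'⟩
  · exact absurd (congrArg Prod.fst eq').symm (H.fst_ne_atom _ hG _)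
  · exact absurd (congrArg Prod.fst eq).symm (H.fst_ne_atom _ hG' _)
  · refine Or.inr ⟨(q'.2, q.2), ⟨q.1, ?_, hq⟩,
      Prod.ext (congrArg Prod.snd eq' :) (congrArg Prod.snd eq :)⟩
    have : q'.1 = q.1 := V.atom_injective t
      ((congrArg Prod.fst eq').trans (congrArg Prod.fst eq).symm)
    exact this ▸ hq'

end

end Sim

theorem encard_range_fin_le {α : Type*} {n : ℕ} (f : Fin n → α) : (Set.range f).encard ≤ n := by
  rw [← Set.image_univ]
  refine (Set.encard_image_le _ _).trans ?_
  simp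

open Classical in
/-- If the number of the sets that are defined by each of the formulas is not large, then these
sets depend only on the quantifier-free type of the atoms among the parameters. -/
theorem State.homogeneous_of_dichotomy [Finite M] [Nonempty M] {S : State M Υ.m₁ t}
    (H : Sim τ k S S S.diag) (hbf : BackForth τ M M k s) (hsk : s ≤ k)
    (hψ : ∀ i, SubformulasHaveFewFreeVars s (Υ.ψ i)) (hlen : ∀ i, Υ.len i ≤ s)
    {large : ℕ∞ → Prop} (hd : Dichotomy τ M s large)
    (hlarge : ∀ i, ∀ c ≤ (S.family Υ i).encard, ¬ large c) : S.Homogeneous k := by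
  intro i b b' h hh hb
  have hlen' : ((Υ.len i : ℕ) : ℕ∞) ≤ s := by exact_mod_cast hlen i
  have hsk' : (s : ℕ∞) ≤ k := by exact_mod_cast hsk
  -- `w x` keeps the sets in `b` and replaces its atoms by those of `x`; the entries of `x` at the
  -- positions of sets are ignored.
  let w : (Fin (Υ.len i) → M) → Fin (Υ.len i) → S.N := fun x j =>
    if ∃ a, (b j : V M t) = V.atom t a then ⟨V.atom t (x j), H.atom_mem_fst _⟩ else b j
  have hw : ∀ {h' : Set (M × M)} {x y : Fin (Υ.len i) → M}, (∀ j, (x j, y j) ∈ h') →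
      ∀ j, ((w x j : V M t), (w y j : V M t)) ∈ withAtoms S.diag h' := by
    intro h' x y hxy j
    by_cases hj : ∃ a, (b j : V M t) = V.atom t a
    · simpa only [w, if_pos hj] using atom_mem_withAtoms (hxy j)
    · simp only [w, if_neg hj]
      exact Or.inl ⟨rfl, (b j).2, not_exists.1 hj⟩
  let F : (Fin (Υ.len i) → M) → Set (V M t) := fun x => S.familySet i (w x)
  obtain ⟨φ, hφ, hφR⟩ := exists_qf_of_invariant (τ := τ) (M₁ := M)
    (fun z : Fin (Υ.len i) ⊕ Fin (Υ.len i) → M => F (z ∘ Sum.inl) = F (z ∘ Sum.inr)) (by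
      intro z z' hz e
      ext y
      by_cases hy : y ∈ S.N
      -- Both parameter tuples are matched at once, which takes up to `2 * s` pairs, and the tested
      -- element `y` requires one more. This is what fixes the size bound in `BackForth`.
      · obtain ⟨x, h', -, hsub, hh', hxy⟩ := H.exists_of_mem_snd hbf hz.lpIso (by
          rw [← Set.image_univ]
          refine (Set.encard_image_le _ _).trans ?_
          simp only [Set.encard_univ, ENat.card_eq_coe_fintype_card, Fintype.card_sum,
            Fintype.card_fin]
          have := hlen i
          exact_mod_cast (by omega)) hy
        have h₁ := H.mem_familySet_iff hbf hsk hψ hh' (hw fun j => hsub ⟨Sum.inl j, rfl⟩) hxy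
        have h₂ := H.mem_familySet_iff hbf hsk hψ hh' (hw fun j => hsub ⟨Sum.inr j, rfl⟩) hxy
        exact h₁.symm.trans ((Set.ext_iff.1 e x).trans h₂)
      · exact iff_of_false (fun h => hy (S.familySet_subset _ _ h))
          fun h => hy (S.familySet_subset _ _ h))
  have hF : ∀ x y, F x = F y ↔ φ.Realize (Sum.elim x y) := fun x y => hφR (Sum.elim x y)
  rcases hd _ (hlen i) φ hφ (Setoid.ker F) hF with hL | htype
  -- The classes correspond to the values of `F`, which all belong to the family.
  · refine absurd hL (hlarge i _ ?_)
    rw [ENat.card_congr (Setoid.quotientKerEquivRange F), ENat.card_coe_set_eq]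
    refine Set.encard_le_encard ?_
    rintro _ ⟨x, rfl⟩
    exact ⟨w x, rfl⟩
  · obtain ⟨h₀, hsub, hc, hb₀⟩ := Sim.exists_small (I := Set.univ) fun j _ => hb j
    replace hc : h₀.encard ≤ (2 * s : ℕ) := by
      refine hc.trans ?_
      have := hlen i
      simp only [Set.encard_univ, ENat.card_eq_coe_fintype_card, Fintype.card_fin]
      exact_mod_cast (by omega)
    -- The extra pair fills the positions at which `b` has a set, so that full tuples of atoms of
    -- the same type are available for the dichotomy.
    obtain ⟨m', hm'⟩ := hbf.forth h₀ (hh.mono hsub) hc (Classical.arbitrary M)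
    have hp : ∀ j, ∃ p ∈ insert (Classical.arbitrary M, m') h₀,
        (∃ a, (b j : V M t) = V.atom t a) →
          (b j : V M t) = V.atom t p.1 ∧ (b' j : V M t) = V.atom t p.2 := by
      intro j
      rcases hb₀ j trivial with hG | ⟨q, hq, e⟩
      · exact ⟨_, Set.mem_insert _ _, fun ⟨a, ha⟩ => absurd ha (hG.2.2 a)⟩
      · exact ⟨q, Set.mem_insert_of_mem _ hq, fun _ =>
          ⟨(congrArg Prod.fst e).symm, (congrArg Prod.snd e).symm⟩⟩
    choose p hp hpb using hp
    have hP : PIso τ (Set.range fun j => ((p j).1, (p j).2)) :=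
      hm' _ (Set.range_subset_iff.2 hp) ((encard_range_fin_le _).trans (hlen'.trans hsk'))
    have hwb : w (fun j => (p j).1) = b := by
      funext j
      by_cases hj : ∃ a, (b j : V M t) = V.atom t a
      · simp only [w, if_pos hj]
        exact Subtype.ext (hpb j hj).1.symm
      · simp only [w, if_neg hj]
    have hwb' : w (fun j => (p j).2) = b' := by
      funext j
      by_cases hj : ∃ a, (b j : V M t) = V.atom t a
      · simp only [w, if_pos hj]
        exact Subtype.ext (hpb j hj).2.symm
      · simp only [w, if_neg hj]
        rcases hb₀ j trivial with hG | ⟨q, hq, e⟩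
        · exact Subtype.ext hG.1
        · exact absurd ⟨_, (congrArg Prod.fst e).symm⟩ hj
    obtain ⟨T, hT, hTE⟩ := htype fun j => (p j).1
    have hE := (hTE fun j => (p j).2).2 fun θ hθ =>
      (hP.realize_qf_iff (hT θ hθ)).1 ((hTE fun j => (p j).1).1 rfl θ hθ)
    have hE' : F _ = F _ := hE
    simpa only [F, hwb, hwb'] using hE'

end OneStep

/-! ### Similarity is preserved by the computation -/

section Computations

open FirstOrder.Language

variable {τ : FirstOrder.Language.{u, v}} [τ.IsRelational] {M M₁ M₂ : Type*}
  [τ.Structure M] [τ.Structure M₁] [τ.Structure M₂] {k s t : ℕ} {Υ : InductiveScheme τ}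

/-- The state that follows `S`. -/
def State.next (S : State M Υ.m₁ t) : State M Υ.m₁ (t + 1) :=
  ⟨V.lift t '' S.N ∪ V.ofSet '' ⋃ i, S.family Υ i, fun l => {V.ofSet (S.c Υ l)}⟩

theorem State.lift_mem_next {S : State M Υ.m₁ t} {x : V M t} (hx : x ∈ S.N) :
    V.lift t x ∈ S.next.N :=
  Or.inl ⟨x, hx, rfl⟩

theorem State.familySet_mem_next (S : State M Υ.m₁ t) (i : Fin Υ.m₀)
    (b : Fin (Υ.len i) → S.N) : V.ofSet (S.familySet i b) ∈ S.next.N :=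
  Or.inr ⟨_, Set.mem_iUnion.2 ⟨i, b, rfl⟩, rfl⟩

variable (τ k) in
/-- The pairs of similar sets in the states that follow `S₁` and `S₂`. -/
def nextPairs (S₁ : State M₁ Υ.m₁ t) (S₂ : State M₂ Υ.m₁ t) (G : Set (V M₁ t × V M₂ t)) :
    Set (V M₁ (t + 1) × V M₂ (t + 1)) :=
  {p | p.1 ∈ S₁.next.N ∧ p.2 ∈ S₂.next.N ∧
    ∃ X₁ X₂, Good τ k S₁ S₂ G X₁ X₂ ∧ p = (V.ofSet X₁, V.ofSet X₂)}

namespace Sim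

variable {S₁ : State M₁ Υ.m₁ t} {S₂ : State M₂ Υ.m₁ t} {G : Set (V M₁ t × V M₂ t)}

/-- Old matched sets stay matched: their sets of members lie in the states by transitivity, and they
form a good pair by `Sim.mem_iff`. -/
theorem lift_mem_nextPairs (H : Sim τ k S₁ S₂ G) {x : V M₁ t} {y : V M₂ t} (hxy : (x, y) ∈ G) :
    (V.lift t x, V.lift t y) ∈ nextPairs τ k S₁ S₂ G := by
  have hx := H.fst_mem _ hxy
  have hy := H.snd_mem _ hxy
  refine ⟨State.lift_mem_next hx, State.lift_mem_next hy, {z | V.Mem t z x}, {z | V.Mem t z y},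
    ⟨H.trans_fst x hx, H.trans_snd y hy, fun p hp => H.mem_iff p hp _ hxy⟩, ?_⟩
  rw [V.lift_eq_ofSet (H.fst_ne_atom _ hxy), V.lift_eq_ofSet (H.snd_ne_atom _ hxy)]

theorem nextPairs_eq_iff (H : Sim τ k S₁ S₂ G) (hbf : BackForth τ M₁ M₂ k s)
    {p q : V M₁ (t + 1) × V M₂ (t + 1)} (hp : p ∈ nextPairs τ k S₁ S₂ G)
    (hq : q ∈ nextPairs τ k S₁ S₂ G) : p.1 = q.1 ↔ p.2 = q.2 := by
  obtain ⟨-, -, X₁, X₂, hX, rfl⟩ := hp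
  obtain ⟨-, -, Y₁, Y₂, hY, rfl⟩ := hq
  simpa only [V.ofSet_injective.eq_iff] using H.eq_iff_of_good hbf hX hY

/-- The states that follow similar states are similar. -/
theorem next (H : Sim τ k S₁ S₂ G) (hbf : BackForth τ M₁ M₂ k s) (hsk : s ≤ k)
    [Nonempty M₁] [Nonempty M₂] (hψ : ∀ i, SubformulasHaveFewFreeVars s (Υ.ψ i))
    (hφ : ∀ l, SubformulasHaveFewFreeVars s (Υ.φ l)) (hlen : ∀ i, Υ.len i ≤ s)
    (hom : S₂.Homogeneous k) : Sim τ k S₁.next S₂.next (nextPairs τ k S₁ S₂ G) := by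
  have htotal : ∀ x ∈ S₁.next.N, (∃ a, x = V.atom (t + 1) a) ∨
      ∃ y, (x, y) ∈ nextPairs τ k S₁ S₂ G := by
    rintro _ (⟨x, hx, rfl⟩ | ⟨_, hX, rfl⟩)
    · rcases H.total x hx with ⟨a, rfl⟩ | ⟨y, hxy⟩
      · exact Or.inl ⟨a, V.lift_atom t a⟩
      · exact Or.inr ⟨_, H.lift_mem_nextPairs hxy⟩
    · obtain ⟨i, b, rfl⟩ := Set.mem_iUnion.1 hX
      obtain ⟨b', h, -, hh, hb⟩ := H.exists_tuple hbf hbf.empty.lpIso (c := 0) (by simp)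
        (by have := hlen i; omega) b
      exact Or.inr ⟨_, S₁.familySet_mem_next i b, S₂.familySet_mem_next i b', _, _,
        H.good_familySet hbf hsk hψ hlen hom hh hb, rfl⟩
  have hsurj : ∀ y ∈ S₂.next.N, (∃ a, y = V.atom (t + 1) a) ∨
      ∃ x, (x, y) ∈ nextPairs τ k S₁ S₂ G := by
    rintro _ (⟨y, hy, rfl⟩ | ⟨_, hX, rfl⟩)
    · rcases H.surj y hy with ⟨a, rfl⟩ | ⟨x, hxy⟩
      · exact Or.inl ⟨a, V.lift_atom t a⟩
      · exact Or.inr ⟨_, H.lift_mem_nextPairs hxy⟩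
    · obtain ⟨i, b', rfl⟩ := Set.mem_iUnion.1 hX
      -- Only the choice of parameters is made backwards. Goodness is still proved in the forward
      -- direction, since only `S₂` is known to be homogeneous.
      obtain ⟨b, h, -, hh, hb⟩ := H.symm.exists_tuple hbf.symm hbf.symm.empty.lpIso (c := 0)
        (by simp) (by have := hlen i; omega) b'
      exact Or.inr ⟨_, S₁.familySet_mem_next i b, S₂.familySet_mem_next i b', _, _,
        H.good_familySet hbf hsk hψ hlen hom hh.swap fun j =>
          (swap_mem_withAtoms (h := Prod.swap ⁻¹' h)
            (p := ((b' j : V M₂ t), (b j : V M₁ t)))).1 (hb j), rfl⟩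
  refine
    { atom_mem_fst := fun a => Or.inl ⟨_, H.atom_mem_fst a, V.lift_atom t a⟩
      atom_mem_snd := fun a => Or.inl ⟨_, H.atom_mem_snd a, V.lift_atom t a⟩
      fst_mem := fun p hp => hp.1
      snd_mem := fun p hp => hp.2.1
      fst_ne_atom := ?_
      snd_ne_atom := ?_
      total := htotal
      surj := hsurj
      eq_iff := fun p hp q hq => H.nextPairs_eq_iff hbf hp hq
      trans_fst := ?_
      trans_snd := ?_
      pred_iff := ?_
      atom_notMem_fst := fun l a h => V.ofSet_ne_atom _ a h.symm
      atom_notMem_snd := fun l a h => V.ofSet_ne_atom _ a h.symm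
      mem_iff := ?_ }
  · rintro _ ⟨-, -, X₁, X₂, -, rfl⟩ a
    exact V.ofSet_ne_atom _ a
  · rintro _ ⟨-, -, X₁, X₂, -, rfl⟩ a
    exact V.ofSet_ne_atom _ a
  · intro x hx z hz
    rcases htotal x hx with ⟨a, rfl⟩ | ⟨y, -, -, X₁, X₂, hX, e⟩
    · exact absurd hz V.not_mem_atom
    · obtain rfl : x = V.ofSet X₁ := congrArg Prod.fst e
      obtain ⟨w, hw, rfl⟩ := V.mem_ofSet.1 hz
      exact State.lift_mem_next (hX.subset_fst hw)
  · intro y hy z hz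
    rcases hsurj y hy with ⟨a, rfl⟩ | ⟨x, -, -, X₁, X₂, hX, e⟩
    · exact absurd hz V.not_mem_atom
    · obtain rfl : y = V.ofSet X₂ := congrArg Prod.snd e
      obtain ⟨w, hw, rfl⟩ := V.mem_ofSet.1 hz
      exact State.lift_mem_next (hX.subset_snd hw)
  · rintro _ ⟨-, -, X₁, X₂, hX, rfl⟩ l
    -- The sets `c_{t,l}` need not belong to the next states; `Good` does not require this, so they
    -- can be compared all the same.
    exact V.ofSet_injective.eq_iff.trans ((H.eq_iff_of_good hbf hX
      (H.good_c hbf hsk hφ l)).trans V.ofSet_injective.eq_iff.symm)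
  · rintro p hp _ ⟨-, -, X₁, X₂, hX, rfl⟩
    rw [V.mem_ofSet, V.mem_ofSet]
    rcases hp with hp | ⟨⟨a, b⟩, hab, rfl⟩
    · have hpa : (∀ a, p.1 ≠ V.atom (t + 1) a) ∧ ∀ a, p.2 ≠ V.atom (t + 1) a := by
        obtain ⟨-, -, Y₁, Y₂, -, rfl⟩ := hp
        exact ⟨V.ofSet_ne_atom _, V.ofSet_ne_atom _⟩
      constructor
      · rintro ⟨z, hz, e⟩
        -- Since `p.1` is not an atom, neither is `z`. Its partner `z'` lifts to the unique partner
        -- of `p.1`, which is `p.2`.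
        obtain ⟨z', hz'⟩ := (H.total z (hX.subset_fst hz)).resolve_left fun ⟨a, ha⟩ =>
          hpa.1 a (by rw [← e, ha, V.lift_atom])
        exact ⟨z', (hX.mem_iff _ (Or.inl hz')).1 hz,
          (H.nextPairs_eq_iff hbf (H.lift_mem_nextPairs hz') hp).1 e⟩
      · rintro ⟨z', hz', e⟩
        obtain ⟨z, hz⟩ := (H.surj z' (hX.subset_snd hz')).resolve_left fun ⟨a, ha⟩ =>
          hpa.2 a (by rw [← e, ha, V.lift_atom])
        exact ⟨z, (hX.mem_iff _ (Or.inl hz)).2 hz',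
          (H.nextPairs_eq_iff hbf (H.lift_mem_nextPairs hz) hp).2 e⟩
    · have hmem := hX.mem_iff _ (atom_mem_withAtoms hab)
      constructor
      · rintro ⟨z, hz, e⟩
        obtain rfl := V.lift_eq_atom e
        exact ⟨_, hmem.1 hz, V.lift_atom t b⟩
      · rintro ⟨z, hz, e⟩
        obtain rfl := V.lift_eq_atom e
        exact ⟨_, hmem.2 hz, V.lift_atom t a⟩

end Sim

theorem sim_zero (Υ : InductiveScheme τ) : Sim τ k (Υ.state M₁ 0) (Υ.state M₂ 0) ∅ where
  atom_mem_fst _ := trivial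
  atom_mem_snd _ := trivial
  fst_mem _ hp := hp.elim
  snd_mem _ hp := hp.elim
  fst_ne_atom _ hp := hp.elim
  snd_ne_atom _ hp := hp.elim
  total x _ := Or.inl ⟨x, rfl⟩
  surj x _ := Or.inl ⟨x, rfl⟩
  eq_iff _ hp := hp.elim
  trans_fst _ _ _ hz := hz.elim
  trans_snd _ _ _ hz := hz.elim
  pred_iff _ hp := hp.elim
  atom_notMem_fst _ _ := id
  atom_notMem_snd _ _ := id
  mem_iff _ _ _ hq := hq.elim

/-- If a step does not exceed the resources, then it does not form a large number of sets. -/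
theorem InductiveScheme.not_isLarge_of_not_overflows [Finite M] [Nonempty M] {ι : Clock} {T : ℕ∞}
    (hatom : ∀ a, V.atom t a ∈ (Υ.state M t).N) (h : ¬ Υ.Overflows ι M T t) (i : Fin Υ.m₀)
    (c : ℕ∞) (hc : c ≤ ((Υ.state M t).family Υ i).encard) : ¬ ι.IsLarge T c := by
  intro hL
  have key : T ≤ c → T < (Υ.state M (t + 1)).N.encard := by
    intro hT
    have := V.finite (M := M) t
    have hfin : ((Υ.state M t).family Υ i).encard ≠ ⊤ :=
      Set.encard_ne_top_iff.2 (Set.toFinite _)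
    obtain ⟨a⟩ := ‹Nonempty M›
    -- An atom is one element besides the sets of the family. This turns `T ≤ c` into strict
    -- overflow for the clocks that count `N_{t+1}`; for `iota4` largeness is strict already.
    have hnot : V.atom (t + 1) a ∉ V.ofSet '' (Υ.state M t).family Υ i := by
      rintro ⟨X, -, e⟩
      exact V.ofSet_ne_atom X a e
    have hsub : insert (V.atom (t + 1) a) (V.ofSet '' (Υ.state M t).family Υ i) ⊆
        (Υ.state M (t + 1)).N := by
      rintro _ (rfl | ⟨X, hX, rfl⟩)
      · exact Or.inl ⟨_, hatom a, V.lift_atom t a⟩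
      · exact Or.inr ⟨X, Set.mem_iUnion.2 ⟨i, hX⟩, rfl⟩
    refine lt_of_lt_of_le ?_ (Set.encard_le_encard hsub)
    rw [Set.encard_insert_of_notMem hnot, V.ofSet_injective.encard_image]
    exact (hT.trans hc).trans_lt (ENat.lt_add_one_iff hfin |>.2 le_rfl)
  cases ι with
  | iota2 => exact h ((key hL).trans_le le_self_add)
  | iota3 => exact h (key hL)
  | iota4 => exact h ⟨i, lt_of_lt_of_le hL hc⟩

/-- As long as the resources suffice, the computations in the two models are similar. -/
theorem InductiveScheme.exists_sim [Nonempty M₁] [Finite M₂] [Nonempty M₂] {ι : Clock} {T : ℕ∞}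
    (hbf : BackForth τ M₁ M₂ k s) (hbf₂ : BackForth τ M₂ M₂ k s) (hsk : s ≤ k)
    (hdich : Dichotomy τ M₂ s (ι.IsLarge T)) (hlen : ∀ i, Υ.len i ≤ s)
    (hψ : ∀ i, SubformulasHaveFewFreeVars s (Υ.ψ i))
    (hφ : ∀ l, SubformulasHaveFewFreeVars s (Υ.φ l)) :
    ∀ t, (∀ t' < t, ¬ Υ.Overflows ι M₂ T t') → ∃ G, Sim τ k (Υ.state M₁ t) (Υ.state M₂ t) G
  | 0, _ => ⟨∅, sim_zero Υ⟩
  | t + 1, ht => by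
    obtain ⟨G, H⟩ := InductiveScheme.exists_sim hbf hbf₂ hsk hdich hlen hψ hφ t
      fun t' ht' => ht t' (ht'.trans t.lt_succ_self)
    exact ⟨_, H.next hbf hsk hψ hφ hlen (State.homogeneous_of_dichotomy (H.diag hbf) hbf₂ hsk hψ
      hlen hdich (Υ.not_isLarge_of_not_overflows H.atom_mem_snd (ht t t.lt_succ_self)))⟩

theorem InductiveScheme.halts_iff_of_sim [Nonempty M₁] (hbf : BackForth τ M₁ M₂ k s) (hsk : s ≤ k)
    (hφ : ∀ l, SubformulasHaveFewFreeVars s (Υ.φ l)) {G : Set (V M₁ t × V M₂ t)}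
    (H : Sim τ k (Υ.state M₁ t) (Υ.state M₂ t) G) : Υ.Halts M₁ t ↔ Υ.Halts M₂ t :=
  exists_congr fun i => exists_congr fun j => and_congr_right fun _ => and_congr_right fun _ =>
    H.eq_iff_of_good hbf (H.good_c hbf hsk hφ i) (H.good_c hbf hsk hφ j)

theorem InductiveScheme.models_iff_of_sim [Nonempty M₁] (hbf : BackForth τ M₁ M₂ k s) (hsk : s ≤ k)
    {χ : (extLang τ 0).Sentence} (hχ : SubformulasHaveFewFreeVars s χ)
    {G : Set (V M₁ t × V M₂ t)} (H : Sim τ k (Υ.state M₁ t) (Υ.state M₂ t) G) :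
    Υ.Models M₁ t χ ↔ Υ.Models M₂ t χ :=
  H.forget_predicates.realize_iff hbf hsk χ hχ (v := default) (v' := default) (xs := default)
    (xs' := default) hbf.empty.lpIso (by
      rintro (x | x) -
      · exact x.elim
      · exact x.elim0)

end Computations

/-! ### Stopping times -/

section StoppingTimes

variable {τ : FirstOrder.Language.{u, v}} [τ.IsRelational] {M M₁ M₂ : Type*}
  [τ.Structure M] [τ.Structure M₁] [τ.Structure M₂] {k s t : ℕ} {Υ : InductiveScheme τ}
  {ι : Clock}

theorem InductiveScheme.not_stops_of_lt_stopTime {T : ℕ∞} (h : (t : ℕ∞) < Υ.stopTime ι M T) :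
    ¬ Υ.Overflows ι M T t ∧ ¬ Υ.Halts M t := by
  rw [← not_or]
  exact fun hs => absurd h (not_lt.2 (sInf_le ⟨t, rfl, hs⟩))

theorem truthValue_eq_none_of_stopTime_eq_top {χ : (extLang τ 0).Sentence} {T : ℕ → ℕ∞}
    (h : Υ.stopTime ι M (T (Nat.card M)) = ⊤) : truthValue Υ ι χ T M = none :=
  if_neg fun h' => h'.1 h

open Classical in
theorem truthValue_of_stopTime_eq {χ : (extLang τ 0).Sentence} {T : ℕ → ℕ∞}
    (h : Υ.stopTime ι M (T (Nat.card M)) = t) :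
    truthValue Υ ι χ T M = if Υ.Halts M t then some (decide (Υ.Models M t χ)) else none := by
  simp [truthValue, h]

/-- If the computation in `M₁` stops first, then it does not halt successfully. -/
theorem truthValue_eq_none_of_stopTime_lt [Nonempty M₁] [Finite M₂] [Nonempty M₂]
    (hbf : BackForth τ M₁ M₂ k s) (hbf₂ : BackForth τ M₂ M₂ k s) (hsk : s ≤ k) {t₁ t₂ : ℕ → ℕ∞}
    (hdich : Dichotomy τ M₂ s (ι.IsLarge (t₂ (Nat.card M₂)))) (hlen : ∀ i, Υ.len i ≤ s)
    (hψ : ∀ i, SubformulasHaveFewFreeVars s (Υ.ψ i))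
    (hφ : ∀ l, SubformulasHaveFewFreeVars s (Υ.φ l)) (χ : (extLang τ 0).Sentence)
    (hlt : Υ.stopTime ι M₁ (t₁ (Nat.card M₁)) < Υ.stopTime ι M₂ (t₂ (Nat.card M₂))) :
    truthValue Υ ι χ t₁ M₁ = none := by
  obtain ⟨t, ht⟩ := ENat.ne_top_iff_exists.1 hlt.ne_top
  rw [← ht] at hlt
  obtain ⟨G, H⟩ := Υ.exists_sim hbf hbf₂ hsk hdich hlen hψ hφ t fun t' ht' =>
    (Υ.not_stops_of_lt_stopTime (lt_trans (by exact_mod_cast ht') hlt)).1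
  rw [truthValue_of_stopTime_eq ht.symm]
  exact if_neg fun hh =>
    (Υ.not_stops_of_lt_stopTime hlt).2 ((Υ.halts_iff_of_sim hbf hsk hφ H).1 hh)

/-- Similarity at the common stopping time `t` only needs the steps before `t`. A possible overflow
at `t` concerns the step to `t + 1` and does no harm. -/
theorem truthValue_eq_of_stopTime_eq [Nonempty M₁] [Finite M₂] [Nonempty M₂]
    (hbf : BackForth τ M₁ M₂ k s) (hbf₂ : BackForth τ M₂ M₂ k s) (hsk : s ≤ k) {t₁ t₂ : ℕ → ℕ∞}
    (hdich : Dichotomy τ M₂ s (ι.IsLarge (t₂ (Nat.card M₂)))) (hlen : ∀ i, Υ.len i ≤ s)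
    (hψ : ∀ i, SubformulasHaveFewFreeVars s (Υ.ψ i))
    (hφ : ∀ l, SubformulasHaveFewFreeVars s (Υ.φ l)) {χ : (extLang τ 0).Sentence}
    (hχ : SubformulasHaveFewFreeVars s χ)
    (heq : Υ.stopTime ι M₁ (t₁ (Nat.card M₁)) = Υ.stopTime ι M₂ (t₂ (Nat.card M₂))) :
    truthValue Υ ι χ t₁ M₁ = truthValue Υ ι χ t₂ M₂ := by
  by_cases htop : Υ.stopTime ι M₂ (t₂ (Nat.card M₂)) = ⊤
  · rw [truthValue_eq_none_of_stopTime_eq_top htop,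
      truthValue_eq_none_of_stopTime_eq_top (heq.trans htop)]
  obtain ⟨t, ht⟩ := ENat.ne_top_iff_exists.1 htop
  obtain ⟨G, H⟩ := Υ.exists_sim hbf hbf₂ hsk hdich hlen hψ hφ t fun t' ht' =>
    (Υ.not_stops_of_lt_stopTime (by rw [← ht]; exact_mod_cast ht')).1
  rw [truthValue_of_stopTime_eq (heq.trans ht.symm), truthValue_of_stopTime_eq ht.symm]
  congr 1
  · exact propext (Υ.halts_iff_of_sim hbf hsk hφ H)
  · exact congrArg some (decide_eq_decide.2 (Υ.models_iff_of_sim hbf hsk hχ H))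

end StoppingTimes

theorem SmallSubstructuresEmbed.refl (τ : FirstOrder.Language.{u, v}) (M : Type*) [τ.Structure M]
    (k : ℕ) : SmallSubstructuresEmbed τ M k M :=
  fun A _ => ⟨A.subtype⟩

end ChoicelessPTime

open FirstOrder ChoicelessPTime
theorem mainTheorem7 {τ : FirstOrder.Language.{u, v}} [τ.IsRelational]
    [Finite (Σ n, τ.Relations n)]
    (M₁ : Type*) [τ.Structure M₁] [Finite M₁] [Nonempty M₁]
    (M₂ : Type*) [τ.Structure M₂] [Finite M₂] [Nonempty M₂]
    (ι : Clock) (t₁ t₂ : ℕ → ℕ∞) (k s : ℕ) (hsk : 3 * s ≤ k)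
    (helim₁ : HasKElimination τ M₁ k) (helim₂ : HasKElimination τ M₂ k)
    (hdich₁ : Dichotomy τ M₁ s (ι.IsLarge (t₁ (Nat.card M₁))))
    (hdich₂ : Dichotomy τ M₂ s (ι.IsLarge (t₂ (Nat.card M₂))))
    (h₁₂ : SmallSubstructuresEmbed τ M₁ k M₂) (h₂₁ : SmallSubstructuresEmbed τ M₂ k M₁)
    (Υ : InductiveScheme τ) (χ : (extLang τ 0).Sentence)
    (hlen : ∀ i, Υ.len i ≤ s)
    (hψ : ∀ i, SubformulasHaveFewFreeVars s (Υ.ψ i))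
    (hφ : ∀ l, SubformulasHaveFewFreeVars s (Υ.φ l))
    (hχ : SubformulasHaveFewFreeVars s χ) :
    truthValue Υ ι χ t₁ M₁ = truthValue Υ ι χ t₂ M₂ ∨
    (truthValue Υ ι χ t₁ M₁ = none ∧ truthValue Υ ι χ t₂ M₂ ≠ none ∧
      Υ.stopTime ι M₁ (t₁ (Nat.card M₁)) < Υ.stopTime ι M₂ (t₂ (Nat.card M₂))) ∨
    (truthValue Υ ι χ t₂ M₂ = none ∧ truthValue Υ ι χ t₁ M₁ ≠ none ∧
      Υ.stopTime ι M₂ (t₂ (Nat.card M₂)) < Υ.stopTime ι M₁ (t₁ (Nat.card M₁))) := by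
  have hbf : BackForth τ M₁ M₂ k s := .of_kElimination hsk helim₁ helim₂ h₁₂ h₂₁
  -- Back and forth within a single model serves to derive homogeneity from the dichotomy there.
  have hbf₁ : BackForth τ M₁ M₁ k s :=
    .of_kElimination hsk helim₁ helim₁ (.refl τ M₁ k) (.refl τ M₁ k)
  have hbf₂ : BackForth τ M₂ M₂ k s :=
    .of_kElimination hsk helim₂ helim₂ (.refl τ M₂ k) (.refl τ M₂ k)
  have hsk' : s ≤ k := by omega
  rcases lt_trichotomy (Υ.stopTime ι M₁ (t₁ (Nat.card M₁)))
    (Υ.stopTime ι M₂ (t₂ (Nat.card M₂))) with hlt | heq | hlt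
  · have h := truthValue_eq_none_of_stopTime_lt hbf hbf₂ hsk' hdich₂ hlen hψ hφ χ hlt
    by_cases h' : truthValue Υ ι χ t₂ M₂ = none
    · exact Or.inl (h.trans h'.symm)
    · exact Or.inr (Or.inl ⟨h, h', hlt⟩)
  · exact Or.inl (truthValue_eq_of_stopTime_eq hbf hbf₂ hsk' hdich₂ hlen hψ hφ hχ heq)
  · have h := truthValue_eq_none_of_stopTime_lt hbf.symm hbf₁ hsk' hdich₁ hlen hψ hφ χ hlt
    by_cases h' : truthValue Υ ι χ t₁ M₁ = none
    · exact Or.inl (h'.trans h.symm)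
    · exact Or.inr (Or.inr ⟨h, h', hlt⟩)
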